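/- **Setting.** Let $\mathfrak H$ be a Pontryagin space: a complex Hilbert space with a bounded self-adjoint $J$, $J^2=I$, $\dim\ker(J+I)<\infty$, and $[f,g]=(Jf,g)$. Let $\mathfrak L_1,\mathfrak L_2,\mathcal H$ be complex Hilbert spaces. Linear relations are linear subspaces of product spaces. For a relation $T$ in $\mathfrak H$ put $(T-\lambda)^{-1}=\{(f'-\lambda f,f):(f,f')\in T\}$, $(I-zT)^{-1}=\{(f-zf',f):(f,f')\in T\}$, $T^{-1}=\{(f',f):(f,f')\in T\}$ and $T^{-[*]}=\{(g,g'):[f,g]=[f',g']\ \forall (f,f')\in T\}$. Further, $\lambda\in\sigma_p(T)$ iff $(f,\lambda f)\in T$ for some $f\neq0$, and $\lambda\in\rho(T)$ iff $(T-\lambda)^{-1}$ is (the graph of) a bounded everywhere defined operator. Let $V$ be a closed isometric operator in $\mathfrak H$. A linear relation $\Gamma$ from $\mathfrak H^2$ to $\mathfrak L_1\times\mathfrak L_2$ is a *unitary boundary pair* for $V$ if $V=\ker\Gamma$, if $$[f,g]-[f',g']=(u_1,v_1)_{\mathfrak L_1}-(u_2,v_2)_{\mathfrak L_2}\qquad(*)$$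 for all $\{(f,f'),(u_1,u_2)\},\{(g,g'),(v_1,v_2)\}\in\Gamma$, and if every $\{(g,g'),(v_1,v_2)\}$ that satisfies $(*)$ for all $\{(f,f'),(u_1,u_2)\}\in\Gamma$ belongs to $\Gamma$. Let $\Gamma_j=\{\{\hat f,u_j\}:\{\hat f,(u_1,u_2)\}\in\Gamma\}$ and $V_j=\ker\Gamma_j$ $(j=1,2)$. The pair is an *ordinary boundary triple* if $\Gamma_1,\Gamma_2$ are single-valued, $\operatorname{dom}\Gamma=V^{-[*]}$ and $\operatorname{ran}\Gamma=\mathfrak L_1\times\mathfrak L_2$. Put $$\mathcal D=\{|\lambda|<1\}\setminus\sigma_p(V_1),\qquad \mathcal D_e=\{|\lambda|>1\}\setminus\sigma_p(V_2).$$ The Weyl function and the $\gamma$-fields are the relations $$\Theta(\lambda)=\{(u_1,u_2)\},\quad \gamma_1(\lambda)=\{(u_1,f)\}\quad(\lambda\in\mathcal D),\qquad \gamma_2(\lambda)=\{(u_2,f)\}\quad(\lambda\in\mathcal D_e),$$ where $\{(f,\lambda f),(u_1,u_2)\}$ runs through the elements of $\Gamma$ of this form. Let $\Phi_j:\mathcal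 H\to\mathfrak L_j$ $(j=1,2)$ be bounded operators with $\ker(\Phi_1^*\Phi_1+\Phi_2^*\Phi_2)=\{0\}$ and let $$V_\Phi=\{\hat f\in\mathfrak H^2:\{\hat f,(\Phi_1h,\Phi_2h)\}\in\Gamma\text{ for some }h\in\mathcal H\}.$$ **Theorem.** Let $\Gamma$ be a unitary boundary pair for $V$. The relations $\Theta(\lambda),\gamma_1(\lambda)$ $(\lambda\in\mathcal D)$ and $\gamma_2(\lambda)$ $(\lambda\in\mathcal D_e)$ are bounded everywhere defined operators; $\mathcal D\subset\rho(V_1)$ and $\mathcal D_e\subset\rho(V_2)$; for $\lambda\ne0$ one has $1/\bar\lambda\in\mathcal D_e$ if $\lambda\in\mathcal D$, and $1/\bar\lambda\in\mathcal D$ if $\lambda\in\mathcal D_e$. Put $\Theta^\#(\lambda)=\Theta(1/\bar\lambda)^*$, $\gamma_j^\#(\lambda)=\gamma_j(1/\bar\lambda)^{*}$, where the adjoint of a $\gamma$-field is always taken with respect to $[\cdot,\cdot]$ on $\mathfrak H$ and the Hilbert inner product of $\mathfrak L_j$. "Has a bounded inverse" means: is a bijection of the indicated spaces, with bounded inverse.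 If $\lambda\in\mathcal D$, then: (i) $\lambda\in\sigma_p(V_\Phi)\Rightarrow\ker(\Phi_2-\Theta(\lambda)\Phi_1)\ne\{0\}$; (ii) if $\Phi_2-\Theta(\lambda)\Phi_1:\mathcal H\to\mathfrak L_2$ has a bounded inverse, then $\lambda\in\rho(V_\Phi)$ and $$(V_\Phi-\lambda)^{-1}=(V_1-\lambda)^{-1}+\tfrac1\lambda\,\gamma_1(\lambda)\Phi_1(\Phi_2-\Theta(\lambda)\Phi_1)^{-1}\gamma_2^\#(\lambda),$$ where for $\lambda=0$ the factor $\frac1\lambda\gamma_2^\#(\lambda)$ is replaced by $\lim_{w\to0}\frac1w\gamma_2^\#(w)$, which exists in operator norm. If $\lambda\in\mathcal D_e$, then: (iii) $\lambda\in\sigma_p(V_\Phi)\Rightarrow\ker(\Phi_1-\Theta^\#(\lambda)\Phi_2)\neq\{0\}$; (iv) if $\Phi_1-\Theta^\#(\lambda)\Phi_2:\mathcal H\to\mathfrak L_1$ has a bounded inverse, then $\lambda\in\rho(V_\Phi)$ and $$(V_\Phi-\lambda)^{-1}=(V_2-\lambda)^{-1}-\tfrac1\lambda\,\gamma_2(\lambda)\Phi_2(\Phi_1-\Theta^\#(\lambda)\Phi_2)^{-1}\gamma_1^\#(\lambda).$$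 **Corollary.** If $\bar z\in\mathcal D$, then $(I-zV_2)^{-1}$ is a bounded everywhere defined operator and: (i) $z\in\sigma_p(V_\Phi^{-1})\Rightarrow\ker(\Phi_1-\Theta(\bar z)^*\Phi_2)\ne\{0\}$; (ii) if $\Phi_1-\Theta(\bar z)^*\Phi_2:\mathcal H\to\mathfrak L_1$ has a bounded inverse, then $z\in\rho(V_\Phi^{-1})$ and $$(I-zV_\Phi)^{-1}=(I-zV_2)^{-1}+\gamma_2(1/z)\Phi_2(\Phi_1-\Theta(\bar z)^*\Phi_2)^{-1}\gamma_1(\bar z)^*,$$ where for $z=0$ the factor $\gamma_2(1/z)$ is replaced by $\lim_{w\to0}\gamma_2(1/w)=0$ (limit in operator norm). If $\bar z\in\mathcal D_e$, then $(I-zV_1)^{-1}$ is a bounded everywhere defined operator and: (iii) $z\in\sigma_p(V_\Phi^{-1})\Rightarrow\ker(\Phi_2-\Theta(1/z)\Phi_1)\ne\{0\}$; (iv) if $\Phi_2-\Theta(1/z)\Phi_1:\mathcal H\to\mathfrak L_2$ has a bounded inverse, then $z\in\rho(V_\Phi^{-1})$ and $$(I-zV_\Phi)^{-1}=(I-zV_1)^{-1}-\gamma_1(1/z)\Phi_1(\Phi_2-\Theta(1/z)\Phi_1)^{-1}\gamma_2(\bar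 z)^*.$$ If, in addition, $\Gamma$ is an ordinary boundary triple for $V$, then in the theorem and in the corollary all four implications (i)–(iv) (in (ii) and (iv): between bounded invertibility and membership in the resolvent set) are equivalences. -/

import Mathlib

open scoped ComplexConjugate InnerProduct
open Filter Topology

namespace BoundaryPair

noncomputable section

/-! Linear relations. A linear relation from `E` to `F` is a linear subspace of `E × F`. -/

section Relations

variable {E F : Type*} [NormedAddCommGroup E] [NormedSpace ℂ E]
  [NormedAddCommGroup F] [NormedSpace ℂ F]

/-- A linear relation from `E` to `F`. -/
abbrev LinRel (E F : Type*) [NormedAddCommGroup E] [NormedSpace ℂ E]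
    [NormedAddCommGroup F] [NormedSpace ℂ F] : Type _ :=
  Submodule ℂ (E × F)

/-- `dom R = {f : (f, g) ∈ R for some g}`. -/
def relDom (R : LinRel E F) : Submodule ℂ E := R.map (LinearMap.fst ℂ E F)

/-- `ran R = {g : (f, g) ∈ R for some f}`. -/
def relRan (R : LinRel E F) : Submodule ℂ F := R.map (LinearMap.snd ℂ E F)

/-- `ker R = {f : (f, 0) ∈ R}`. -/
def relKer (R : LinRel E F) : Submodule ℂ E := R.comap (LinearMap.inl ℂ E F)

/-- `mul R = {g : (0, g) ∈ R}`. -/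
def relMul (R : LinRel E F) : Submodule ℂ F := R.comap (LinearMap.inr ℂ E F)

/-- The inverse relation `R⁻¹ = {(g, f) : (f, g) ∈ R}`. -/
def relInv (R : LinRel E F) : LinRel F E :=
  R.map ((LinearMap.snd ℂ E F).prod (LinearMap.fst ℂ E F))

/-- The graph of a bounded everywhere defined operator. -/
def opGraph (T : E →L[ℂ] F) : LinRel E F := (T : E →ₗ[ℂ] F).graph

/-- `R` is (the graph of) a bounded everywhere defined operator from `E` to `F`. -/
def IsBoundedOp (R : LinRel E F) : Prop := ∃ T : E →L[ℂ] F, R = opGraph T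

open Classical in
/-- The bounded everywhere defined operator whose graph is `R`
(with value `0` when `R` is not the graph of such an operator). -/
def toOp (R : LinRel E F) : E →L[ℂ] F :=
  if h : IsBoundedOp R then h.choose else 0

/-- The resolvent `(R - lam I)⁻¹ = {(f' - lam f, f) : (f, f') ∈ R}`. -/
def resolventRel (R : LinRel E E) (lam : ℂ) : LinRel E E :=
  R.map ((LinearMap.snd ℂ E E - lam • LinearMap.fst ℂ E E).prod (LinearMap.fst ℂ E E))

/-- The coresolvent `(I - z R)⁻¹ = {(f - z f', f) : (f, f') ∈ R}`. -/
def coresolventRel (R : LinRel E E) (z : ℂ) : LinRel E E :=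
  R.map ((LinearMap.fst ℂ E E - z • LinearMap.snd ℂ E E).prod (LinearMap.fst ℂ E E))

/-- The point spectrum of a linear relation. -/
def pointSpectrum (R : LinRel E E) : Set ℂ := {lam | ∃ f : E, f ≠ 0 ∧ (f, lam • f) ∈ R}

/-- The resolvent set of a linear relation: the points `lam` for which `(R - lam I)⁻¹` is a
bounded everywhere defined operator. -/
def relResolventSet (R : LinRel E E) : Set ℂ := {lam | IsBoundedOp (resolventRel R lam)}

end Relations

/-! Pontryagin spaces. -/

/-- A fundamental symmetry with finite negative index on a complex Hilbert space `H`; it turns `H`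
into the Pontryagin space with inner product `[f, g] = (J f, g)`. The negative part
`H₋ = ker (J + I)` is finite-dimensional. -/
structure PontryaginSymmetry (H : Type*) [NormedAddCommGroup H] [InnerProductSpace ℂ H]
    [CompleteSpace H] where
  J : H →L[ℂ] H
  selfAdjoint : IsSelfAdjoint J
  involutive : ∀ f : H, J (J f) = f
  finite_negative : FiniteDimensional ℂ (J + ContinuousLinearMap.id ℂ H).ker

section Spaces

variable {H L₁ L₂ K : Type*}
  [NormedAddCommGroup H] [InnerProductSpace ℂ H] [CompleteSpace H]
  [NormedAddCommGroup L₁] [InnerProductSpace ℂ L₁] [CompleteSpace L₁]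
  [NormedAddCommGroup L₂] [InnerProductSpace ℂ L₂] [CompleteSpace L₂]
  [NormedAddCommGroup K] [InnerProductSpace ℂ K] [CompleteSpace K]

/-- `[f, g] = (J f, g)`, linear in `f` and conjugate linear in `g`
(Mathlib's `inner` is conjugate linear in its first argument). -/
def PontryaginSymmetry.form (P : PontryaginSymmetry H) (f g : H) : ℂ := inner ℂ g (P.J f)

/-- The adjoint `T^{[*]} = T^* J : H → L` of a bounded operator `T` from the Hilbert space `L` to
the Pontryagin space `H`. -/
def PontryaginSymmetry.adj (P : PontryaginSymmetry H) (T : L₁ →L[ℂ] H) : H →L[ℂ] L₁ :=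
  (ContinuousLinearMap.adjoint T) ∘L P.J

/-- The defining property `(u, T^{[*]} f) = [T u, f]` of the adjoint. -/
theorem PontryaginSymmetry.inner_adj (P : PontryaginSymmetry H) (T : L₁ →L[ℂ] H) (u : L₁) (f : H) :
    inner ℂ (P.adj T f) u = P.form (T u) f := by
  have h := (ContinuousLinearMap.isSelfAdjoint_iff_isSymmetric.mp P.selfAdjoint) f (T u)
  simp only [ContinuousLinearMap.coe_coe] at h
  simp [PontryaginSymmetry.adj, PontryaginSymmetry.form, ContinuousLinearMap.adjoint_inner_left, h]

/-- `V` is a closed isometric operator in the Pontryagin space `H`. -/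
structure IsClosedIsometricOperator (P : PontryaginSymmetry H) (V : LinRel H H) : Prop where
  closed : IsClosed (V : Set (H × H))
  isometric : ∀ f f' : H, (f, f') ∈ V → P.form f' f' = P.form f f
  singleValued : relMul V = ⊥

/-- `V^{-[*]} = {(g, g') : [f, g] = [f', g'] for all (f, f') ∈ V}`, the inverse of the adjoint
relation. -/
def invAdjoint (P : PontryaginSymmetry H) (V : LinRel H H) : LinRel H H where
  carrier := {g | ∀ f ∈ V, P.form f.1 g.1 = P.form f.2 g.2}
  add_mem' := by
    intro a b ha hb f hf
    have h1 := ha f hf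
    have h2 := hb f hf
    simp only [PontryaginSymmetry.form] at h1 h2
    simp [PontryaginSymmetry.form, h1, h2]
  zero_mem' := by
    intro f _
    simp [PontryaginSymmetry.form]
  smul_mem' := by
    intro c a ha f hf
    have h1 := ha f hf
    simp only [PontryaginSymmetry.form] at h1
    simp [PontryaginSymmetry.form, h1]

/-- A linear relation from `H²` to `L₁ × L₂`. -/
abbrev BdryRel (H L₁ L₂ : Type*)
    [NormedAddCommGroup H] [InnerProductSpace ℂ H]
    [NormedAddCommGroup L₁] [InnerProductSpace ℂ L₁]
    [NormedAddCommGroup L₂] [InnerProductSpace ℂ L₂] : Type _ :=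
  LinRel (H × H) (L₁ × L₂)

/-- The identity `[f, g] - [f', g'] = (u₁, v₁) - (u₂, v₂)` for
`a = ((f, f'), (u₁, u₂))` and `b = ((g, g'), (v₁, v₂))`. -/
def GreenIdentity (P : PontryaginSymmetry H) (a b : (H × H) × (L₁ × L₂)) : Prop :=
  P.form a.1.1 b.1.1 - P.form a.1.2 b.1.2 = inner ℂ b.2.1 a.2.1 - inner ℂ b.2.2 a.2.2

/-- `(L₁ × L₂, Γ)` is a unitary boundary pair for `V`. -/
structure IsUnitaryBoundaryPair (P : PontryaginSymmetry H) (V : LinRel H H)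
    (Γ : BdryRel H L₁ L₂) : Prop where
  ker_eq : V = relKer Γ
  green : ∀ a ∈ Γ, ∀ b ∈ Γ, GreenIdentity P a b
  maximal : ∀ b : (H × H) × (L₁ × L₂), (∀ a ∈ Γ, GreenIdentity P a b) → b ∈ Γ

/-- The component `Γ₁ = {(f̂, u₁) : (f̂, (u₁, u₂)) ∈ Γ for some u₂}`. -/
def comp₁ (Γ : BdryRel H L₁ L₂) : LinRel (H × H) L₁ :=
  Γ.map (LinearMap.prodMap LinearMap.id (LinearMap.fst ℂ L₁ L₂))

/-- The component `Γ₂ = {(f̂, u₂) : (f̂, (u₁, u₂)) ∈ Γ for some u₁}`. -/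
def comp₂ (Γ : BdryRel H L₁ L₂) : LinRel (H × H) L₂ :=
  Γ.map (LinearMap.prodMap LinearMap.id (LinearMap.snd ℂ L₁ L₂))

/-- `(L₁ × L₂, Γ₁, Γ₂)` is an ordinary boundary triple for `V`
(to be used for unitary boundary pairs). -/
structure IsOrdinary (P : PontryaginSymmetry H) (V : LinRel H H) (Γ : BdryRel H L₁ L₂) : Prop where
  mul₁ : relMul (comp₁ Γ) = ⊥
  mul₂ : relMul (comp₂ Γ) = ⊥
  dom_eq : relDom Γ = invAdjoint P V
  ran_eq : relRan Γ = ⊤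

/-- `V₁ = ker Γ₁`. -/
def ext₁ (Γ : BdryRel H L₁ L₂) : LinRel H H := relKer (comp₁ Γ)

/-- `V₂ = ker Γ₂`. -/
def ext₂ (Γ : BdryRel H L₁ L₂) : LinRel H H := relKer (comp₂ Γ)

/-- `𝒟 = 𝔻 \ σ_p(V₁)`. -/
def domD (Γ : BdryRel H L₁ L₂) : Set ℂ := {lam | ‖lam‖ < 1 ∧ lam ∉ pointSpectrum (ext₁ Γ)}

/-- `𝒟_e = 𝔻_e \ σ_p(V₂)`. -/
def domDe (Γ : BdryRel H L₁ L₂) : Set ℂ := {lam | 1 < ‖lam‖ ∧ lam ∉ pointSpectrum (ext₂ Γ)}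

/-- The part `{((f, lam f), (u₁, u₂)) ∈ Γ}` of `Γ` over the defect subspace at `lam`, recorded as
the set of `(f, (u₁, u₂))`. -/
def defectPart (Γ : BdryRel H L₁ L₂) (lam : ℂ) : LinRel H (L₁ × L₂) :=
  Γ.comap (LinearMap.prodMap (LinearMap.id.prod (lam • LinearMap.id)) LinearMap.id)

/-- The Weyl family `{(u₁, u₂) : ((f, lam f), (u₁, u₂)) ∈ Γ for some f}`. -/
def weylFamily (Γ : BdryRel H L₁ L₂) (lam : ℂ) : LinRel L₁ L₂ := relRan (defectPart Γ lam)

/-- `{(u₁, f) : ((f, lam f), (u₁, u₂)) ∈ Γ for some u₂}`. -/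
def gammaRel₁ (Γ : BdryRel H L₁ L₂) (lam : ℂ) : LinRel L₁ H :=
  (defectPart Γ lam).map
    ((LinearMap.fst ℂ L₁ L₂ ∘ₗ LinearMap.snd ℂ H (L₁ × L₂)).prod (LinearMap.fst ℂ H (L₁ × L₂)))

/-- `{(u₂, f) : ((f, lam f), (u₁, u₂)) ∈ Γ for some u₁}`. -/
def gammaRel₂ (Γ : BdryRel H L₁ L₂) (lam : ℂ) : LinRel L₂ H :=
  (defectPart Γ lam).map
    ((LinearMap.snd ℂ L₁ L₂ ∘ₗ LinearMap.snd ℂ H (L₁ × L₂)).prod (LinearMap.fst ℂ H (L₁ × L₂)))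

/-- The Weyl function `Θ(lam)`, for `lam ∈ 𝒟`. -/
def weyl (Γ : BdryRel H L₁ L₂) (lam : ℂ) : L₁ →L[ℂ] L₂ := toOp (weylFamily Γ lam)

/-- The γ-field `γ₁(lam)`, for `lam ∈ 𝒟`. -/
def gamma₁ (Γ : BdryRel H L₁ L₂) (lam : ℂ) : L₁ →L[ℂ] H := toOp (gammaRel₁ Γ lam)

/-- The γ-field `γ₂(lam)`, for `lam ∈ 𝒟_e`. -/
def gamma₂ (Γ : BdryRel H L₁ L₂) (lam : ℂ) : L₂ →L[ℂ] H := toOp (gammaRel₂ Γ lam)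

/-- `Θ^#(lam) = Θ(1 / conj lam)^*`, for `lam ∈ 𝒟_e`. -/
def weylSharp (Γ : BdryRel H L₁ L₂) (lam : ℂ) : L₂ →L[ℂ] L₁ :=
  ContinuousLinearMap.adjoint (weyl Γ (1 / conj lam))

/-- `γ₁^#(lam) = γ₁(1 / conj lam)^{[*]}`, for `lam ∈ 𝒟_e`. -/
def gammaSharp₁ (P : PontryaginSymmetry H) (Γ : BdryRel H L₁ L₂) (lam : ℂ) : H →L[ℂ] L₁ :=
  P.adj (gamma₁ Γ (1 / conj lam))

/-- `γ₂^#(lam) = γ₂(1 / conj lam)^{[*]}`, for `lam ∈ 𝒟 \ {0}`. -/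
def gammaSharp₂ (P : PontryaginSymmetry H) (Γ : BdryRel H L₁ L₂) (lam : ℂ) : H →L[ℂ] L₂ :=
  P.adj (gamma₂ Γ (1 / conj lam))

/-- `V_Φ = {f̂ : (f̂, (Φ₁ h, Φ₂ h)) ∈ Γ for some h}`. -/
def extΦ (Γ : BdryRel H L₁ L₂) (Φ₁ : K →L[ℂ] L₁) (Φ₂ : K →L[ℂ] L₂) : LinRel H H where
  carrier := {f | ∃ h : K, (f, (Φ₁ h, Φ₂ h)) ∈ Γ}
  add_mem' := by
    rintro a b ⟨h, hh⟩ ⟨k, hk⟩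
    exact ⟨h + k, by simpa using Γ.add_mem hh hk⟩
  zero_mem' := ⟨0, by
    rw [map_zero, map_zero]
    exact Γ.zero_mem⟩
  smul_mem' := by
    rintro c a ⟨h, hh⟩
    exact ⟨c • h, by simpa using Γ.smul_mem c hh⟩

end Spaces

end

end BoundaryPair

open BoundaryPair

namespace BoundaryPair

noncomputable section

/-! ### Linear relations, their inverses and (co)resolvents. -/

section Relations

variable {E F : Type*} [NormedAddCommGroup E] [NormedSpace ℂ E]
  [NormedAddCommGroup F] [NormedSpace ℂ F]

/-! Everything rests on one fact: for `λ ∈ 𝒟` the map `((f, f'), (u₁, u₂)) ↦ (f' - λ f, u₁)` is a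
bijection, hence a Banach isomorphism, from `Γ` onto `H × L₁` (`defectMap_isInvertible`). Then `Γ`
is described by `f = R k + G u₁`, `u₂ = B k + Θ u₁` with `k = f' - λ f` (`IsParametrization`). Here
`R` is the resolvent of `V₁`, `G` the γ-field and `Θ` the Weyl function. Inserting `u_j = Φ_j x`
gives `(Φ₂ - Θ Φ₁) x = B k`, and solving for `x` yields the resolvent formula and the spectral
statements.

To see the bijection, write `f = f₊ + f₋` along the eigenspaces of `J` and put `p = f₊ + f'₋`, `q =
f'₊ + f₋` (the Potapov–Ginzburg transform `mix`). The indefinite Green identity becomes an equality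
of Hilbert inner products for `(p, u₂)` and `(q, u₁)`, and maximality makes `Γ` the graph of an
isometry `(q, u₁) ↦ (p, u₂)` defined everywhere (`outputMap_bijective`). For `u₁ = 0` it induces a
contraction `C : q ↦ p`, and `f' - λ f` differs by a finite rank operator from `q - λ (C q)₊`, which
is invertible as `|λ| < 1`. Since `λ ∉ σ_p(V₁)` gives injectivity, surjectivity follows.

The exterior of the disc is reached by symmetry: exchanging `f, f'` and `u₁, u₂` gives a unitary
boundary pair for `V⁻¹`, with `V₂⁻¹` in the role of `V₁` and `V_Φ⁻¹` in that of `V_Φ`. The Green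
identity at `λ` and `conj λ` shows that the Weyl function of the swapped pair is `Θ*` and that its
`B` is the adjoint of `γ₁`; swapping back identifies `B` as `(1 / λ) γ₂^#(λ)`. Limits at `0` come
from norm continuity of inversion. -/

theorem mem_relInv {R : LinRel E F} {f : E} {g : F} : (g, f) ∈ relInv R ↔ (f, g) ∈ R := by
  constructor
  · rintro ⟨⟨a, b⟩, h, e⟩
    obtain ⟨rfl, rfl⟩ := Prod.mk.inj e
    exact h
  · exact fun h => ⟨(f, g), h, rfl⟩

theorem mem_resolventRel {R : LinRel E E} {lam : ℂ} {k f : E} :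
    (k, f) ∈ resolventRel R lam ↔ (f, k + lam • f) ∈ R := by
  constructor
  · rintro ⟨⟨a, b⟩, h, e⟩
    obtain ⟨rfl, rfl⟩ := Prod.mk.inj e
    simpa using h
  · exact fun h => ⟨_, h, by simp⟩

theorem mem_coresolventRel {R : LinRel E E} {z : ℂ} {k f : E} :
    (k, f) ∈ coresolventRel R z ↔ ∃ f', (f, f') ∈ R ∧ f - z • f' = k := by
  constructor
  · rintro ⟨⟨a, b⟩, h, e⟩
    obtain ⟨rfl, rfl⟩ := Prod.mk.inj e
    exact ⟨b, h, rfl⟩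
  · rintro ⟨f', h, rfl⟩
    exact ⟨_, h, by simp⟩

theorem mem_opGraph {T : E →L[ℂ] F} {x : E} {y : F} : (x, y) ∈ opGraph T ↔ y = T x := by
  simp [opGraph, LinearMap.mem_graph_iff]

theorem opGraph_injective : Function.Injective (opGraph : (E →L[ℂ] F) → LinRel E F) := by
  intro S T h
  ext x
  have : (x, S x) ∈ opGraph T := h ▸ mem_opGraph.2 rfl
  exact mem_opGraph.1 this

theorem toOp_opGraph (T : E →L[ℂ] F) : toOp (opGraph T) = T := by
  have h : IsBoundedOp (opGraph T) := ⟨T, rfl⟩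
  rw [toOp, dif_pos h]
  exact opGraph_injective h.choose_spec.symm

/-- The coresolvent of `R` is `I + z (R⁻¹ - z)⁻¹`. -/
theorem coresolventRel_eq_opGraph {R : LinRel E E} {z : ℂ} {T : E →L[ℂ] E}
    (h : resolventRel (relInv R) z = opGraph T) :
    coresolventRel R z = opGraph (ContinuousLinearMap.id ℂ E + z • T) := by
  ext ⟨k, f⟩
  have key : ∀ f' : E, (k + z • f', f') ∈ R ↔ f' = T k := fun f' => by
    rw [← mem_relInv, ← mem_resolventRel, h, mem_opGraph]
  rw [mem_coresolventRel, mem_opGraph]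
  constructor
  · rintro ⟨f', hf, e⟩
    have e' : f = k + z • f' := by rw [← e]; abel
    rw [e', key] at hf
    simp [e', ← hf]
  · intro e
    refine ⟨T k, ?_, by simp [e]⟩
    rw [show f = k + z • T k by simp [e], key]

/-- Resolvents of `R⁻¹` and of `R`: `(R - λ)⁻¹ = -λ⁻¹ (I - λ⁻¹ R)⁻¹`. -/
theorem resolventRel_eq_opGraph_of_coresolventRel {R : LinRel E E} {lam : ℂ} (hlam : lam ≠ 0)
    {T : E →L[ℂ] E} (h : coresolventRel R (1 / lam) = opGraph T) :
    resolventRel R lam = opGraph (-((1 / lam) • T)) := by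
  ext ⟨k, f⟩
  have h1 : (-((1 / lam) • k), f) ∈ coresolventRel R (1 / lam) ↔ (k, f) ∈ resolventRel R lam := by
    rw [mem_coresolventRel, mem_resolventRel]
    constructor
    · rintro ⟨f', hf, e⟩
      convert hf using 2
      have : lam • (f - (1 / lam) • f') = lam • -((1 / lam) • k) := by rw [e]
      simp only [smul_sub, smul_neg, smul_smul, mul_one_div_cancel hlam, one_smul] at this
      rw [← neg_eq_iff_eq_neg] at this
      rw [← this]; abel
    · intro hf
      refine ⟨_, hf, ?_⟩
      simp only [smul_add, smul_smul, one_div_mul_cancel hlam, one_smul]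
      abel
  rw [← h1, h, mem_opGraph, mem_opGraph]
  simp

theorem coresolventRel_eq_opGraph_of_resolventRel {R : LinRel E E} {lam : ℂ} (hlam : lam ≠ 0)
    {T : E →L[ℂ] E} (h : resolventRel R lam = opGraph T) :
    coresolventRel R (1 / lam) = opGraph (-(lam • T)) := by
  ext ⟨k, f⟩
  have h1 : (k, f) ∈ coresolventRel R (1 / lam) ↔ (-(lam • k), f) ∈ resolventRel R lam := by
    rw [mem_coresolventRel, mem_resolventRel]
    constructor
    · rintro ⟨f', hf, rfl⟩
      convert hf using 2
      simp [smul_sub, smul_smul, hlam]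
    · intro hf
      refine ⟨_, hf, ?_⟩
      simp [smul_smul, hlam]
  rw [h1, h, mem_opGraph, mem_opGraph]
  simp

theorem relInv_relInv (R : LinRel E F) : relInv (relInv R) = R := by
  ext ⟨f, g⟩
  rw [mem_relInv, mem_relInv]

theorem mem_pointSpectrum_relInv {R : LinRel E E} {lam : ℂ} (hlam : lam ≠ 0) :
    1 / lam ∈ pointSpectrum (relInv R) ↔ lam ∈ pointSpectrum R := by
  constructor
  · rintro ⟨f, hf, h⟩
    rw [mem_relInv] at h
    exact ⟨(1 / lam) • f, by simp [hf, hlam], by simpa [smul_smul, hlam] using h⟩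
  · rintro ⟨f, hf, h⟩
    refine ⟨lam • f, by simp [hf, hlam], ?_⟩
    rw [mem_relInv]
    simpa [smul_smul, hlam] using h

theorem mem_relResolventSet_relInv {R : LinRel E E} {lam : ℂ} (hlam : lam ≠ 0) :
    1 / lam ∈ relResolventSet (relInv R) ↔ lam ∈ relResolventSet R := by
  have aux : ∀ {S : LinRel E E} {mu : ℂ}, mu ≠ 0 → 1 / mu ∈ relResolventSet (relInv S) →
      mu ∈ relResolventSet S := by
    rintro S mu hmu ⟨T, hT⟩
    -- The coresolvent of `S` at `1 / mu` links the resolvents of `S⁻¹` and `S`.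
    exact ⟨_, resolventRel_eq_opGraph_of_coresolventRel hmu (coresolventRel_eq_opGraph hT)⟩
  refine ⟨aux hlam, fun h => aux (one_div_ne_zero hlam) ?_⟩
  rwa [one_div_one_div, relInv_relInv]

end Relations

/-! ### Boundary relations, the swap symmetry and the defect map. -/

section Boundary

variable {H L₁ L₂ K : Type*}
  [NormedAddCommGroup H] [InnerProductSpace ℂ H]
  [NormedAddCommGroup L₁] [InnerProductSpace ℂ L₁]
  [NormedAddCommGroup L₂] [InnerProductSpace ℂ L₂]
  [NormedAddCommGroup K] [InnerProductSpace ℂ K]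

theorem mem_ext₁ {Γ : BdryRel H L₁ L₂} {f f' : H} :
    (f, f') ∈ ext₁ Γ ↔ ∃ u₂, ((f, f'), ((0 : L₁), u₂)) ∈ Γ := by
  constructor
  · rintro ⟨⟨⟨a, b⟩, u, v⟩, h, e⟩
    obtain ⟨e₁, rfl⟩ := Prod.mk.inj e
    obtain ⟨rfl, rfl⟩ := Prod.mk.inj e₁
    exact ⟨v, h⟩
  · rintro ⟨v, h⟩
    exact ⟨_, h, rfl⟩

theorem mem_ext₂ {Γ : BdryRel H L₁ L₂} {f f' : H} :
    (f, f') ∈ ext₂ Γ ↔ ∃ u₁, ((f, f'), (u₁, (0 : L₂))) ∈ Γ := by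
  constructor
  · rintro ⟨⟨⟨a, b⟩, u, v⟩, h, e⟩
    obtain ⟨e₁, rfl⟩ := Prod.mk.inj e
    obtain ⟨rfl, rfl⟩ := Prod.mk.inj e₁
    exact ⟨u, h⟩
  · rintro ⟨v, h⟩
    exact ⟨_, h, rfl⟩

theorem mem_weylFamily {Γ : BdryRel H L₁ L₂} {lam : ℂ} {u₁ : L₁} {u₂ : L₂} :
    (u₁, u₂) ∈ weylFamily Γ lam ↔ ∃ f, ((f, lam • f), (u₁, u₂)) ∈ Γ := by
  constructor
  · rintro ⟨⟨f, u⟩, h, rfl⟩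
    exact ⟨f, h⟩
  · rintro ⟨f, h⟩
    exact ⟨(f, (u₁, u₂)), h, rfl⟩

theorem mem_gammaRel₁ {Γ : BdryRel H L₁ L₂} {lam : ℂ} {u₁ : L₁} {f : H} :
    (u₁, f) ∈ gammaRel₁ Γ lam ↔ ∃ u₂, ((f, lam • f), (u₁, u₂)) ∈ Γ := by
  constructor
  · rintro ⟨⟨g, u, v⟩, h, e⟩
    obtain ⟨rfl, rfl⟩ := Prod.mk.inj e
    exact ⟨v, h⟩
  · rintro ⟨u₂, h⟩
    exact ⟨(f, (u₁, u₂)), h, rfl⟩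

theorem mem_gammaRel₂ {Γ : BdryRel H L₁ L₂} {lam : ℂ} {u₂ : L₂} {f : H} :
    (u₂, f) ∈ gammaRel₂ Γ lam ↔ ∃ u₁, ((f, lam • f), (u₁, u₂)) ∈ Γ := by
  constructor
  · rintro ⟨⟨g, u, v⟩, h, e⟩
    obtain ⟨rfl, rfl⟩ := Prod.mk.inj e
    exact ⟨u, h⟩
  · rintro ⟨u₁, h⟩
    exact ⟨(f, (u₁, u₂)), h, rfl⟩

/-- The boundary relation `{((f', f), (u₂, u₁)) : ((f, f'), (u₁, u₂)) ∈ Γ}`, which belongs to the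
inverse of the isometric operator. -/
def swapRel (Γ : BdryRel H L₁ L₂) : BdryRel H L₂ L₁ :=
  Γ.comap (((LinearEquiv.prodComm ℂ H H).prodCongr (LinearEquiv.prodComm ℂ L₂ L₁)) :
    (H × H) × (L₂ × L₁) →ₗ[ℂ] (H × H) × (L₁ × L₂))

theorem mem_swapRel {Γ : BdryRel H L₁ L₂} {f f' : H} {u₁ : L₁} {u₂ : L₂} :
    ((f, f'), (u₂, u₁)) ∈ swapRel Γ ↔ ((f', f), (u₁, u₂)) ∈ Γ := Iff.rfl

theorem swapRel_swapRel (Γ : BdryRel H L₁ L₂) : swapRel (swapRel Γ) = Γ := rfl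

theorem ext₁_swapRel (Γ : BdryRel H L₁ L₂) : ext₁ (swapRel Γ) = relInv (ext₂ Γ) := by
  ext ⟨f, f'⟩
  simp only [mem_relInv, mem_ext₁, mem_ext₂, mem_swapRel]

theorem extΦ_swapRel (Γ : BdryRel H L₁ L₂) (Φ₁ : K →L[ℂ] L₁) (Φ₂ : K →L[ℂ] L₂) :
    extΦ (swapRel Γ) Φ₂ Φ₁ = relInv (extΦ Γ Φ₁ Φ₂) := by
  ext ⟨f, f'⟩
  rw [mem_relInv]
  rfl

/-- Inversion exchanges the disc and its exterior, and the eigenvalues of `V₂` and `V₂⁻¹`. The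
condition `lam ≠ 0` is needed because `1 / 0 = 0` may lie in `domD (swapRel Γ)`. -/
theorem mem_domDe_iff {Γ : BdryRel H L₁ L₂} {lam : ℂ} :
    lam ∈ domDe Γ ↔ lam ≠ 0 ∧ 1 / lam ∈ domD (swapRel Γ) := by
  by_cases h : lam = 0
  · simp [h, domDe]
  · simp only [domDe, domD, Set.mem_ofPred_eq, ext₁_swapRel, mem_pointSpectrum_relInv h, norm_div,
      norm_one, ne_eq, h, not_false_eq_true, true_and]
    rw [div_lt_one (norm_pos_iff.2 h)]

/-- The map `((f, f'), (u₁, u₂)) ↦ (f' - lam f, u₁)`. -/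
def defectMap (Γ : BdryRel H L₁ L₂) (lam : ℂ) : Γ →L[ℂ] H × L₁ :=
  ((ContinuousLinearMap.snd ℂ H H - lam • ContinuousLinearMap.fst ℂ H H).prodMap
    (ContinuousLinearMap.fst ℂ L₁ L₂)) ∘L Γ.subtypeL

theorem defectMap_apply (Γ : BdryRel H L₁ L₂) (lam : ℂ) (a : Γ) :
    defectMap Γ lam a = (a.1.1.2 - lam • a.1.1.1, a.1.2.1) := rfl

theorem continuous_sub_smul {E F : Type*} [NormedAddCommGroup E] [NormedSpace ℂ E]
    [NormedAddCommGroup F] [NormedSpace ℂ F] (A S : E →L[ℂ] F) :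
    Continuous fun w : ℂ => A - w • S := by
  fun_prop

theorem continuous_defectMap (Γ : BdryRel H L₁ L₂) : Continuous (defectMap Γ) := by
  have h : defectMap Γ = fun w => defectMap Γ 0 - w • (ContinuousLinearMap.inl ℂ H L₁ ∘L
      ContinuousLinearMap.fst ℂ H H ∘L ContinuousLinearMap.fst ℂ (H × H) (L₁ × L₂) ∘L
      Γ.subtypeL) := by
    ext w a <;> simp [defectMap_apply]
  rw [h]
  exact continuous_sub_smul _ _

theorem eq_zero_of_mem_of_relMul_eq_bot {Γ : BdryRel H L₁ L₂}
    (h₁ : relMul (comp₁ Γ) = ⊥) (h₂ : relMul (comp₂ Γ) = ⊥)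
    (u₁ : L₁) (u₂ : L₂) (h : ((0 : H × H), (u₁, u₂)) ∈ Γ) : u₁ = 0 ∧ u₂ = 0 := by
  constructor
  · have : u₁ ∈ relMul (comp₁ Γ) := ⟨_, h, rfl⟩
    rwa [h₁, Submodule.mem_bot] at this
  · have : u₂ ∈ relMul (comp₂ Γ) := ⟨_, h, rfl⟩
    rwa [h₂, Submodule.mem_bot] at this

end Boundary

/-- A perturbation of a bijective linear map by a linear map of finite rank is surjective if it is
injective. -/
theorem surjective_of_finiteRank_perturbation {𝕜 E : Type*} [Field 𝕜] [AddCommGroup E] [Module 𝕜 E]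
    (N : E ≃ₗ[𝕜] E) (M : E →ₗ[𝕜] E) (S : Submodule 𝕜 E) [FiniteDimensional 𝕜 S]
    (h : ∀ x, M x - N x ∈ S) (hM : Function.Injective M) : Function.Surjective M := by
  -- `A = N⁻¹ M` is the identity modulo `S' = N⁻¹ S`, so it maps the finite-dimensional `S'`
  -- injectively, hence onto, itself.
  let S' : Submodule 𝕜 E := S.map (N.symm : E →ₗ[𝕜] E)
  let A : E →ₗ[𝕜] E := (N.symm : E →ₗ[𝕜] E) ∘ₗ M
  have hA : ∀ x, A x - x ∈ S' := fun x => ⟨_, h x, by simp [A]⟩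
  have hAS : ∀ x ∈ S', A x ∈ S' := fun x hx => by
    simpa using S'.add_mem (hA x) hx
  have hAi : Function.Injective A := N.symm.injective.comp hM
  have hs : Function.Surjective (A.restrict hAS) :=
    LinearMap.surjective_of_injective fun x y hxy =>
      Subtype.ext (hAi (congrArg Subtype.val hxy))
  intro y
  obtain ⟨⟨s, hs'⟩, hsy⟩ := hs ⟨_, hA (N.symm y)⟩
  have hsy' : A s = A (N.symm y) - N.symm y := congrArg Subtype.val hsy
  -- The defect `A (N⁻¹ y) - N⁻¹ y` lies in `S'` and equals `A s`, so subtracting `s` corrects it.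
  refine ⟨N.symm y - s, N.symm.injective ?_⟩
  change A (N.symm y - s) = _
  rw [map_sub, hsy']
  abel

/-! ### The Potapov–Ginzburg transform and the Green identity. -/

section Spaces

variable {H L₁ L₂ : Type*}
  [NormedAddCommGroup H] [InnerProductSpace ℂ H] [CompleteSpace H]
  [NormedAddCommGroup L₁] [InnerProductSpace ℂ L₁]
  [NormedAddCommGroup L₂] [InnerProductSpace ℂ L₂]

namespace PontryaginSymmetry

variable (P : PontryaginSymmetry H)

/-- The projection onto `ker (J - I)`. -/
def posProj : H →L[ℂ] H := (1 / 2 : ℂ) • (ContinuousLinearMap.id ℂ H + P.J)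

/-- The projection onto `ker (J + I)`. -/
def negProj : H →L[ℂ] H := (1 / 2 : ℂ) • (ContinuousLinearMap.id ℂ H - P.J)

theorem inner_J_left (f g : H) : inner ℂ (P.J f) g = inner ℂ f (P.J g) :=
  (ContinuousLinearMap.isSelfAdjoint_iff_isSymmetric.mp P.selfAdjoint) f g

theorem posProj_apply (f : H) : P.posProj f = (1 / 2 : ℂ) • (f + P.J f) := rfl

theorem negProj_apply (f : H) : P.negProj f = (1 / 2 : ℂ) • (f - P.J f) := rfl

theorem posProj_add_negProj (f : H) : P.posProj f + P.negProj f = f := by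
  rw [posProj_apply, negProj_apply, ← smul_add, add_add_sub_cancel, ← two_smul ℂ f, smul_smul]
  norm_num

theorem posProj_posProj (f : H) : P.posProj (P.posProj f) = P.posProj f := by
  simp only [posProj_apply, map_smul, map_add, P.involutive]
  module

theorem negProj_negProj (f : H) : P.negProj (P.negProj f) = P.negProj f := by
  simp only [negProj_apply, map_smul, map_sub, P.involutive]
  module

theorem posProj_negProj (f : H) : P.posProj (P.negProj f) = 0 := by
  simp only [posProj_apply, negProj_apply, map_smul, map_sub, P.involutive]
  module

theorem negProj_posProj (f : H) : P.negProj (P.posProj f) = 0 := by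
  simp only [posProj_apply, negProj_apply, map_smul, map_add, P.involutive]
  module

theorem negProj_mem (f : H) : P.negProj f ∈ (P.J + ContinuousLinearMap.id ℂ H).ker := by
  simp only [LinearMap.mem_ker, negProj_apply, ContinuousLinearMap.coe_coe,
    add_apply, map_smul, map_sub, P.involutive, ContinuousLinearMap.id_apply]
  module

theorem inner_posProj_add_inner_negProj (f g : H) :
    inner ℂ (P.posProj f) (P.posProj g) + inner ℂ (P.negProj f) (P.negProj g) = inner ℂ f g := by
  simp only [posProj_apply, negProj_apply, inner_smul_left, inner_smul_right, inner_add_left,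
    inner_add_right, inner_sub_left, inner_sub_right, inner_J_left, P.involutive, map_div₀,
    map_one, Complex.conj_ofNat]
  ring

theorem form_eq_inner_sub_inner (f g : H) : P.form f g =
    inner ℂ (P.posProj g) (P.posProj f) - inner ℂ (P.negProj g) (P.negProj f) := by
  simp only [form, posProj_apply, negProj_apply, inner_smul_left, inner_smul_right,
    inner_add_left, inner_add_right, inner_sub_left, inner_sub_right, inner_J_left, P.involutive,
    map_div₀, map_one, Complex.conj_ofNat]
  ring

theorem norm_posProj_le (f : H) : ‖P.posProj f‖ ≤ ‖f‖ := by
  have h := P.inner_posProj_add_inner_negProj f f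
  simp only [inner_self_eq_norm_sq_to_K] at h
  norm_cast at h
  nlinarith [norm_nonneg (P.posProj f), norm_nonneg f, sq_nonneg ‖P.negProj f‖]

/-- `(f, f') ↦ f₊ + f'₋`, where `f₊` and `f₋` are the components of `f` in `ker (J - I)` and
`ker (J + I)`. -/
def mix : H × H →L[ℂ] H :=
  P.posProj ∘L ContinuousLinearMap.fst ℂ H H + P.negProj ∘L ContinuousLinearMap.snd ℂ H H

theorem mix_apply (f f' : H) : P.mix (f, f') = P.posProj f + P.negProj f' := rfl

theorem posProj_mix (f f' : H) : P.posProj (P.mix (f, f')) = P.posProj f := by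
  simp [mix_apply, posProj_posProj, posProj_negProj]

theorem negProj_mix (f f' : H) : P.negProj (P.mix (f, f')) = P.negProj f' := by
  simp [mix_apply, negProj_negProj, negProj_posProj]

/-- The transform only exchanges the negative components of `f` and `f'`, so it is an involution and
`(f, f')` can be recovered. -/
theorem mix_mix (f f' : H) : P.mix (P.mix (f, f'), P.mix (f', f)) = f := by
  rw [mix_apply, posProj_mix, negProj_mix, posProj_add_negProj]

/-- Exchanging the negative components moves the negative terms across the difference, leaving
Hilbert inner products only. -/
theorem form_sub_form (f f' g g' : H) : P.form f g - P.form f' g' =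
    inner ℂ (P.mix (g, g')) (P.mix (f, f')) - inner ℂ (P.mix (g', g)) (P.mix (f', f)) := by
  rw [← P.inner_posProj_add_inner_negProj (P.mix (g, g')),
    ← P.inner_posProj_add_inner_negProj (P.mix (g', g)), form_eq_inner_sub_inner,
    form_eq_inner_sub_inner]
  simp only [posProj_mix, negProj_mix]
  ring

end PontryaginSymmetry

theorem GreenIdentity_iff_mix (P : PontryaginSymmetry H) (f f' g g' : H) (u₁ v₁ : L₁)
    (u₂ v₂ : L₂) : GreenIdentity P ((f, f'), (u₁, u₂)) ((g, g'), (v₁, v₂)) ↔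
    inner ℂ (P.mix (g, g')) (P.mix (f, f')) + inner ℂ v₂ u₂ =
      inner ℂ (P.mix (g', g)) (P.mix (f', f)) + inner ℂ v₁ u₁ := by
  simp only [GreenIdentity, P.form_sub_form]
  constructor <;> intro h <;> linear_combination h

/-- The exchange multiplies both sides of the Green identity by `-1`. -/
theorem IsUnitaryBoundaryPair.swap {P : PontryaginSymmetry H} {V : LinRel H H}
    {Γ : BdryRel H L₁ L₂} (hΓ : IsUnitaryBoundaryPair P V Γ) :
    IsUnitaryBoundaryPair P (relInv V) (swapRel Γ) := by
  have aux : ∀ (a b : (H × H) × (L₂ × L₁)), GreenIdentity P a b ↔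
      GreenIdentity P (a.1.swap, a.2.swap) (b.1.swap, b.2.swap) := by
    intro a b
    simp only [GreenIdentity, Prod.fst_swap, Prod.snd_swap]
    constructor <;> intro h <;> linear_combination -h
  refine ⟨?_, fun a ha b hb => (aux a b).2 (hΓ.green _ ha _ hb), fun b hb => ?_⟩
  · ext ⟨f, f'⟩
    rw [mem_relInv, hΓ.ker_eq]
    rfl
  · exact hΓ.maximal (b.1.swap, b.2.swap) fun a ha =>
      (aux (a.1.swap, a.2.swap) b).1 (hb (a.1.swap, a.2.swap) ha)

/-- By maximality `Γ` is its own orthogonal companion, an intersection of closed conditions. -/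
theorem IsUnitaryBoundaryPair.isClosed {P : PontryaginSymmetry H} {V : LinRel H H}
    {Γ : BdryRel H L₁ L₂} (hΓ : IsUnitaryBoundaryPair P V Γ) :
    IsClosed (Γ : Set ((H × H) × (L₁ × L₂))) := by
  have : (Γ : Set ((H × H) × (L₁ × L₂))) = ⋂ a ∈ Γ, {b | GreenIdentity P a b} := by
    ext b
    simp only [SetLike.mem_coe, Set.mem_iInter, Set.mem_ofPred_eq]
    exact ⟨fun hb a ha => hΓ.green a ha b hb, hΓ.maximal b⟩
  rw [this]
  refine isClosed_biInter fun a _ => ?_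
  simp only [GreenIdentity, PontryaginSymmetry.form]
  exact isClosed_eq (by fun_prop) (by fun_prop)

/-- The map `((f, f'), (u₁, u₂)) ↦ (f'₊ + f₋, u₁)` into the Hilbert sum of `H` and `L₁`. -/
def outputMap (P : PontryaginSymmetry H) (Γ : BdryRel H L₁ L₂) : Γ →L[ℂ] WithLp 2 (H × L₁) :=
  (WithLp.prodContinuousLinearEquiv 2 ℂ H L₁).symm.toContinuousLinearMap ∘L
    ((P.mix ∘L (ContinuousLinearEquiv.prodComm ℂ H H).toContinuousLinearMap ∘L
      ContinuousLinearMap.fst ℂ (H × H) (L₁ × L₂)).prod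
      (ContinuousLinearMap.fst ℂ L₁ L₂ ∘L ContinuousLinearMap.snd ℂ (H × H) (L₁ × L₂))) ∘L
    Γ.subtypeL

theorem outputMap_apply (P : PontryaginSymmetry H) (Γ : BdryRel H L₁ L₂) (f f' : H) (u₁ : L₁)
    (u₂ : L₂) (h : ((f, f'), (u₁, u₂)) ∈ Γ) :
    outputMap P Γ ⟨_, h⟩ = WithLp.toLp 2 (P.mix (f', f), u₁) := rfl

theorem IsUnitaryBoundaryPair.norm_sq_eq {P : PontryaginSymmetry H} {V : LinRel H H}
    {Γ : BdryRel H L₁ L₂} (hΓ : IsUnitaryBoundaryPair P V Γ) {f f' : H} {u₁ : L₁} {u₂ : L₂}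
    (h : ((f, f'), (u₁, u₂)) ∈ Γ) :
    ‖P.mix (f, f')‖ ^ 2 + ‖u₂‖ ^ 2 = ‖P.mix (f', f)‖ ^ 2 + ‖u₁‖ ^ 2 := by
  have := (GreenIdentity_iff_mix P f f' f f' u₁ u₁ u₂ u₂).1 (hΓ.green _ h _ h)
  simp only [inner_self_eq_norm_sq_to_K] at this
  exact_mod_cast this

/-- The Green identity in terms of `k = f' - lam f` and `l = g - conj lam g'`. -/
theorem IsUnitaryBoundaryPair.form_sub_form_defect {P : PontryaginSymmetry H}
    {V : LinRel H H} {Γ : BdryRel H L₁ L₂} (hΓ : IsUnitaryBoundaryPair P V Γ) {lam : ℂ} {f k g l : H}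
    {u₁ v₁ : L₁} {u₂ v₂ : L₂} (ha : ((f, k + lam • f), (u₁, u₂)) ∈ Γ)
    (hb : ((g, l + conj lam • g), (v₂, v₁)) ∈ swapRel Γ) :
    P.form f l - P.form k g = inner ℂ v₁ u₁ - inner ℂ v₂ u₂ := by
  have h := hΓ.green _ ha _ (mem_swapRel.1 hb)
  simp only [GreenIdentity, PontryaginSymmetry.form, map_add, map_smul, inner_add_left,
    inner_add_right, inner_smul_left, inner_smul_right, Complex.conj_conj] at h
  simp only [PontryaginSymmetry.form]
  linear_combination h

end Spaces

/-! ### Invertibility of the defect map on `𝒟`. -/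

section Spaces

variable {H L₁ L₂ : Type*}
  [NormedAddCommGroup H] [InnerProductSpace ℂ H] [CompleteSpace H]
  [NormedAddCommGroup L₁] [InnerProductSpace ℂ L₁]
  [NormedAddCommGroup L₂] [InnerProductSpace ℂ L₂]
  {P : PontryaginSymmetry H} {V : LinRel H H} {Γ : BdryRel H L₁ L₂}

theorem IsUnitaryBoundaryPair.defectMap_injective_iff (hΓ : IsUnitaryBoundaryPair P V Γ)
    {lam : ℂ} :
    Function.Injective (defectMap Γ lam) ↔ lam ∉ pointSpectrum (ext₁ Γ) := by
  constructor
  · rintro h ⟨f, hf, hmem⟩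
    obtain ⟨u₂, hu⟩ := mem_ext₁.1 hmem
    have h0 : (⟨_, hu⟩ : Γ) = 0 := h (by simp [defectMap_apply])
    exact hf (congrArg (fun a : Γ => a.1.1.1) h0)
  · intro h
    rw [injective_iff_map_eq_zero]
    rintro ⟨⟨⟨f, f'⟩, u₁, u₂⟩, hu⟩ h0
    obtain ⟨h1, h2⟩ := Prod.mk.inj h0
    have hf' : f' = lam • f := sub_eq_zero.1 h1
    have hu₁ : u₁ = 0 := h2
    subst hf' hu₁
    have hf : f = 0 := by
      by_contra hf
      exact h ⟨f, hf, mem_ext₁.2 ⟨u₂, hu⟩⟩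
    subst hf
    -- With `f = f' = 0` and `u₁ = 0` the norm identity leaves `‖u₂‖² = 0`.
    have hn := hΓ.norm_sq_eq hu
    have hu₂ : u₂ = 0 := by simpa using hn
    subst hu₂
    simp

/-- The norm identity bounds `p`, `q`, `u₁`, `u₂` by the output; `mix` recovers `f`, `f'` at the
cost of `‖P.mix‖`, and the `1` in the maximum serves `u₁`, `u₂`. -/
theorem IsUnitaryBoundaryPair.norm_le_outputMap (hΓ : IsUnitaryBoundaryPair P V Γ) (a : Γ) :
    ‖a‖ ≤ max ‖P.mix‖ 1 * ‖outputMap P Γ a‖ := by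
  obtain ⟨⟨⟨f, f'⟩, u₁, u₂⟩, h⟩ := a
  have hn := hΓ.norm_sq_eq h
  set r := ‖outputMap P Γ ⟨_, h⟩‖ with hr
  have hr2 : r ^ 2 = ‖P.mix (f', f)‖ ^ 2 + ‖u₁‖ ^ 2 := by
    rw [hr, outputMap_apply, WithLp.prod_norm_sq_eq_of_L2]
    rfl
  have hr0 : 0 ≤ r := norm_nonneg _
  have hq : ‖P.mix (f', f)‖ ≤ r := abs_le_of_sq_le_sq' (by nlinarith [sq_nonneg ‖u₁‖]) hr0 |>.2
  have hu₁ : ‖u₁‖ ≤ r := abs_le_of_sq_le_sq' (by nlinarith [sq_nonneg ‖P.mix (f', f)‖]) hr0 |>.2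
  have hp : ‖P.mix (f, f')‖ ≤ r := abs_le_of_sq_le_sq' (by nlinarith [sq_nonneg ‖u₂‖]) hr0 |>.2
  have hu₂ : ‖u₂‖ ≤ r := abs_le_of_sq_le_sq' (by nlinarith [sq_nonneg ‖P.mix (f, f')‖]) hr0 |>.2
  have hf : ‖f‖ ≤ ‖P.mix‖ * r := by
    rw [← P.mix_mix f f']
    exact P.mix.le_opNorm_of_le (max_le hp hq)
  have hf' : ‖f'‖ ≤ ‖P.mix‖ * r := by
    rw [← P.mix_mix f' f]
    exact P.mix.le_opNorm_of_le (max_le hq hp)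
  have h1 : ‖P.mix‖ * r ≤ max ‖P.mix‖ 1 * r :=
    mul_le_mul_of_nonneg_right (le_max_left _ _) hr0
  have h2 : r ≤ max ‖P.mix‖ 1 * r := le_mul_of_one_le_left hr0 (le_max_right _ _)
  exact max_le (max_le (hf.trans h1) (hf'.trans h1)) (max_le (hu₁.trans h2) (hu₂.trans h2))

variable [CompleteSpace L₁] [CompleteSpace L₂]

theorem IsUnitaryBoundaryPair.completeSpace (hΓ : IsUnitaryBoundaryPair P V Γ) :
    CompleteSpace Γ :=
  hΓ.isClosed.completeSpace_coe

/-- The lower bound gives injectivity and closed range; maximality leaves nothing orthogonal to the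
range. -/
theorem IsUnitaryBoundaryPair.outputMap_bijective (hΓ : IsUnitaryBoundaryPair P V Γ) :
    Function.Bijective (outputMap P Γ) := by
  have := hΓ.completeSpace
  have hanti : AntilipschitzWith (max ‖P.mix‖₊ 1) (outputMap P Γ) :=
    (outputMap P Γ).antilipschitz_of_bound hΓ.norm_le_outputMap
  refine ⟨hanti.injective, ?_⟩
  have hcl : IsClosed ((outputMap P Γ).range : Set (WithLp 2 (H × L₁))) := by
    rw [LinearMap.coe_range]
    exact hanti.isClosed_range (outputMap P Γ).uniformContinuous
  have : CompleteSpace (outputMap P Γ).range := hcl.completeSpace_coe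
  refine LinearMap.range_eq_top.1 ((Submodule.orthogonal_eq_bot_iff).1 ?_)
  rw [Submodule.eq_bot_iff]
  intro y hy
  obtain ⟨⟨q, v⟩, rfl⟩ := (WithLp.equiv 2 (H × L₁)).symm.surjective y
  -- The element with transform `p = 0`, output `(q, v)` and `u₂ = 0`: orthogonality is its Green
  -- identity with all of `Γ`, and the norm identity then forces `q = v = 0`.
  have hmem : ((P.mix (0, q), P.mix (q, 0)), (v, (0 : L₂))) ∈ Γ := by
    refine hΓ.maximal _ fun a ha => ?_
    obtain ⟨⟨f, f'⟩, u₁, u₂⟩ := a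
    rw [GreenIdentity_iff_mix, P.mix_mix, P.mix_mix]
    have := (Submodule.mem_orthogonal' _ _).1 hy _ ⟨⟨_, ha⟩, rfl⟩
    rw [ContinuousLinearMap.coe_coe, outputMap_apply, WithLp.prod_inner_apply] at this
    simpa using this.symm
  have hn := hΓ.norm_sq_eq hmem
  rw [P.mix_mix, P.mix_mix] at hn
  simp only [norm_zero] at hn
  have hq : q = 0 := norm_eq_zero.1 (by nlinarith [sq_nonneg ‖q‖, sq_nonneg ‖v‖])
  have hv : v = 0 := norm_eq_zero.1 (by nlinarith [sq_nonneg ‖q‖, sq_nonneg ‖v‖])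
  rw [hq, hv]
  rfl

theorem IsUnitaryBoundaryPair.defectMap_surjective (hΓ : IsUnitaryBoundaryPair P V Γ)
    {lam : ℂ} (hlam : lam ∈ domD Γ) : Function.Surjective (defectMap Γ lam) := by
  have hinj := hΓ.defectMap_injective_iff.2 hlam.2
  let E : Γ ≃ₗ[ℂ] WithLp 2 (H × L₁) := LinearEquiv.ofBijective
    (outputMap P Γ : Γ →ₗ[ℂ] WithLp 2 (H × L₁)) hΓ.outputMap_bijective
  -- `e a` is the element of `Γ` with `q = a` and `u₁ = 0`.
  let e : H →ₗ[ℂ] Γ := (E.symm : WithLp 2 (H × L₁) →ₗ[ℂ] Γ) ∘ₗ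
    ((WithLp.linearEquiv 2 ℂ (H × L₁)).symm : H × L₁ →ₗ[ℂ] WithLp 2 (H × L₁)) ∘ₗ
    LinearMap.inl ℂ H L₁
  have hE : ∀ a, E (e a) = WithLp.toLp 2 (a, 0) := fun a => E.apply_symm_apply _
  have he : ∀ a, P.mix ((e a).1.1.2, (e a).1.1.1) = a ∧ (e a).1.2.1 = 0 := fun a => by
    have h : WithLp.toLp 2 (P.mix ((e a).1.1.2, (e a).1.1.1), (e a).1.2.1) =
        WithLp.toLp 2 (a, 0) := hE a
    exact Prod.mk.inj (WithLp.toLp_injective 2 h)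
  let C : H →L[ℂ] H := LinearMap.mkContinuous
    ((P.mix : H × H →ₗ[ℂ] H) ∘ₗ LinearMap.fst ℂ (H × H) (L₁ × L₂) ∘ₗ Γ.subtype ∘ₗ e) 1
    (fun a => by
      have h := hΓ.norm_sq_eq (e a).2
      rw [(he a).1, (he a).2, norm_zero] at h
      rw [one_mul]
      exact abs_le_of_sq_le_sq'
        (a := ‖P.mix ((e a).1.1.1, (e a).1.1.2)‖)
        (by nlinarith [sq_nonneg ‖(e a).1.2.2‖]) (norm_nonneg a) |>.2)
  have hC : ∀ a, C a = P.mix (e a).1.1 := fun a => rfl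
  have hCn : ‖lam • (P.posProj ∘L C)‖ < 1 := by
    have h1 : ‖P.posProj ∘L C‖ ≤ 1 := ContinuousLinearMap.opNorm_le_bound _ zero_le_one fun a =>
      (P.norm_posProj_le _).trans
        (C.le_of_opNorm_le (LinearMap.mkContinuous_norm_le _ zero_le_one _) a)
    rw [norm_smul]
    exact lt_of_le_of_lt (mul_le_of_le_one_right (norm_nonneg _) h1) hlam.1
  -- Neumann series; this is where `‖lam‖ < 1` enters.
  let N : H ≃ₗ[ℂ] H := (ContinuousLinearEquiv.unitsEquiv ℂ H
    (Units.oneSub (lam • (P.posProj ∘L C)) hCn)).toLinearEquiv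
  have hN : ∀ a, N a = a - lam • P.posProj (C a) := fun a => rfl
  let M : H →ₗ[ℂ] H := LinearMap.fst ℂ H L₁ ∘ₗ (defectMap Γ lam : Γ →ₗ[ℂ] H × L₁) ∘ₗ e
  have hM : ∀ a, M a = (e a).1.1.2 - lam • (e a).1.1.1 := fun a => rfl
  have hdM : ∀ a, defectMap Γ lam (e a) = (M a, 0) := fun a => by
    rw [defectMap_apply, (he a).2, hM]
  have := P.finite_negative
  have hMs : Function.Surjective M := by
    refine surjective_of_finiteRank_perturbation N M (P.J + ContinuousLinearMap.id ℂ H).ker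
      (fun a => ?_) fun a b hab => ?_
    · have h1 : (e a).1.1.2 = P.mix (a, C a) := by
        conv_lhs => rw [← P.mix_mix (e a).1.1.2 (e a).1.1.1, (he a).1]
        rfl
      have h2 : (e a).1.1.1 = P.mix (C a, a) := by
        conv_lhs => rw [← P.mix_mix (e a).1.1.1 (e a).1.1.2, (he a).1]
        rfl
      -- The positive components of `M a` and `N a` agree, so the difference lies in the
      -- finite-dimensional `ker (J + I)`.
      have h3 : M a - N a = P.negProj (C a - lam • a - a) := by
        rw [hM, hN, h1, h2, P.mix_apply, P.mix_apply, map_sub, map_sub, map_smul]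
        refine sub_eq_zero.1 (Eq.trans ?_ (sub_eq_zero.2 (P.posProj_add_negProj a)))
        module
      rw [h3]
      exact P.negProj_mem _
    · have h1 : e a = e b := hinj (by rw [hdM, hdM, hab])
      rw [← (he a).1, h1, (he b).1]
  rintro ⟨k, u⟩
  -- `b` supplies the boundary value `u`; an element `e a`, with `u₁ = 0`, then adjusts `k`.
  let b : Γ := E.symm (WithLp.toLp 2 (0, u))
  have hb : b.1.2.1 = u := by
    have h : WithLp.toLp 2 (P.mix (b.1.1.2, b.1.1.1), b.1.2.1) = WithLp.toLp 2 ((0 : H), u) :=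
      E.apply_symm_apply _
    exact (Prod.mk.inj (WithLp.toLp_injective 2 h)).2
  obtain ⟨a, ha⟩ := hMs (k - (defectMap Γ lam b).1)
  refine ⟨e a + b, ?_⟩
  rw [map_add, hdM, ha]
  ext
  · simp
  · simpa [defectMap_apply] using hb

theorem IsUnitaryBoundaryPair.defectMap_isInvertible (hΓ : IsUnitaryBoundaryPair P V Γ)
    {lam : ℂ} (hlam : lam ∈ domD Γ) : (defectMap Γ lam).IsInvertible := by
  have := hΓ.completeSpace
  exact ⟨ContinuousLinearEquiv.ofBijective (defectMap Γ lam)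
    (LinearMap.ker_eq_bot.2 (hΓ.defectMap_injective_iff.2 hlam.2))
    (LinearMap.range_eq_top.2 (hΓ.defectMap_surjective hlam)), rfl⟩

end Spaces

/-! ### Consequences of the parametrization: Krein-type formula and spectrum. -/

section Parametrization

variable {H L₁ L₂ K : Type*}
  [NormedAddCommGroup H] [InnerProductSpace ℂ H]
  [NormedAddCommGroup L₁] [InnerProductSpace ℂ L₁]
  [NormedAddCommGroup L₂] [InnerProductSpace ℂ L₂]
  [NormedAddCommGroup K] [InnerProductSpace ℂ K]

/-- The elements of `Γ` are parametrized by `k = f' - lam f` and `u₁`, with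
`f = R k + G u₁` and `u₂ = B k + Θ u₁`. -/
def IsParametrization (Γ : BdryRel H L₁ L₂) (lam : ℂ) (R : H →L[ℂ] H) (G : L₁ →L[ℂ] H)
    (B : H →L[ℂ] L₂) (Θ : L₁ →L[ℂ] L₂) : Prop :=
  ∀ (f f' : H) (u₁ : L₁) (u₂ : L₂), ((f, f'), (u₁, u₂)) ∈ Γ ↔
    f = R (f' - lam • f) + G u₁ ∧ u₂ = B (f' - lam • f) + Θ u₁

namespace IsParametrization

variable {Γ : BdryRel H L₁ L₂} {lam : ℂ} {R : H →L[ℂ] H} {G : L₁ →L[ℂ] H} {B : H →L[ℂ] L₂}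
  {Θ : L₁ →L[ℂ] L₂} (h : IsParametrization Γ lam R G B Θ)

include h

theorem mem (k : H) (u : L₁) :
    ((R k + G u, k + lam • (R k + G u)), (u, B k + Θ u)) ∈ Γ := by
  rw [h]
  simp

theorem mem_defect_iff (f : H) (u₁ : L₁) (u₂ : L₂) :
    ((f, lam • f), (u₁, u₂)) ∈ Γ ↔ f = G u₁ ∧ u₂ = Θ u₁ := by
  rw [h]
  simp

theorem weylFamily_eq : weylFamily Γ lam = opGraph Θ := by
  ext ⟨u₁, u₂⟩
  simp only [mem_weylFamily, mem_opGraph, h.mem_defect_iff, exists_and_right, exists_eq, true_and]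

theorem gammaRel₁_eq : gammaRel₁ Γ lam = opGraph G := by
  ext ⟨u₁, f⟩
  simp only [mem_gammaRel₁, mem_opGraph, h.mem_defect_iff, exists_and_left, exists_eq, and_true]

theorem weyl_eq : weyl Γ lam = Θ := by
  rw [weyl, h.weylFamily_eq, toOp_opGraph]

theorem gamma₁_eq : gamma₁ Γ lam = G := by
  rw [gamma₁, h.gammaRel₁_eq, toOp_opGraph]

theorem resolventRel_ext₁_eq : resolventRel (ext₁ Γ) lam = opGraph R := by
  ext ⟨k, f⟩
  simp only [mem_resolventRel, mem_ext₁, mem_opGraph, h _ _ _ _]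
  simp

variable {Φ₁ : K →L[ℂ] L₁} {Φ₂ : K →L[ℂ] L₂}

theorem ker_ne_bot_of_mem_pointSpectrum (hlam : lam ∈ pointSpectrum (extΦ Γ Φ₁ Φ₂)) :
    (Φ₂ - Θ ∘L Φ₁).ker ≠ ⊥ := by
  obtain ⟨f, hf, k, hk⟩ := hlam
  rw [h.mem_defect_iff] at hk
  rw [Submodule.ne_bot_iff]
  refine ⟨k, by simp [hk.2], ?_⟩
  rintro rfl
  exact hf (by simp [hk.1])

/-- Membership in `Γ` with `u_j = Φ_j x` says `(Φ₂ - Θ Φ₁) x = B k` and `f = R k + G Φ₁ x`;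
eliminate `x`. -/
theorem resolventRel_extΦ_eq (hinv : (Φ₂ - Θ ∘L Φ₁).IsInvertible) :
    resolventRel (extΦ Γ Φ₁ Φ₂) lam =
      opGraph (R + G ∘L Φ₁ ∘L (Φ₂ - Θ ∘L Φ₁).inverse ∘L B) := by
  obtain ⟨e, he⟩ := hinv
  have he' : ∀ x, Φ₂ x = e x + Θ (Φ₁ x) := fun x => by
    have := congrArg (· x) he
    simp only [ContinuousLinearEquiv.coe_coe] at this
    simp [this]
  rw [← he, ContinuousLinearMap.inverse_equiv]
  ext ⟨k, f⟩
  rw [mem_resolventRel, mem_opGraph]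
  change (∃ x, ((f, k + lam • f), (Φ₁ x, Φ₂ x)) ∈ Γ) ↔ _
  simp only [h _ _ _ _, add_sub_cancel_right, he', add_left_inj, ← e.eq_symm_apply]
  simp

/-- A kernel vector `x` yields the candidate eigenvector `G Φ₁ x`. If it vanished, `(Φ₁ x, Φ₂ x)`
would lie in `mul Γ = {0}`, so `x = 0`. -/
theorem mem_pointSpectrum_iff (hΦ : ∀ x, Φ₁ x = 0 → Φ₂ x = 0 → x = 0)
    (hmul : ∀ u₁ u₂, ((0 : H × H), (u₁, u₂)) ∈ Γ → u₁ = 0 ∧ u₂ = 0) :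
    lam ∈ pointSpectrum (extΦ Γ Φ₁ Φ₂) ↔ (Φ₂ - Θ ∘L Φ₁).ker ≠ ⊥ := by
  refine ⟨h.ker_ne_bot_of_mem_pointSpectrum, fun hk => ?_⟩
  obtain ⟨x, hx, hx0⟩ := (Submodule.ne_bot_iff _).1 hk
  have hx' : Φ₂ x = Θ (Φ₁ x) := sub_eq_zero.1 hx
  have hm := (h.mem_defect_iff _ (Φ₁ x) (Φ₂ x)).2 ⟨rfl, hx'⟩
  refine ⟨G (Φ₁ x), fun h0 => hx0 ?_, x, hm⟩
  rw [h0, smul_zero] at hm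
  obtain ⟨h1, h2⟩ := hmul _ _ hm
  exact hΦ x h1 h2

/-- A kernel vector would produce an eigenvector. For surjectivity, full range of `Γ` realizes every
`v` as `B k`, and the resolvent at this `k` provides `x` with `(Φ₂ - Θ Φ₁) x = B k`. -/
theorem isInvertible_of_mem_relResolventSet [CompleteSpace K] [CompleteSpace L₂]
    (hΦ : ∀ x, Φ₁ x = 0 → Φ₂ x = 0 → x = 0)
    (hmul : ∀ u₁ u₂, ((0 : H × H), (u₁, u₂)) ∈ Γ → u₁ = 0 ∧ u₂ = 0) (hran : relRan Γ = ⊤)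
    (hlam : lam ∈ relResolventSet (extΦ Γ Φ₁ Φ₂)) : (Φ₂ - Θ ∘L Φ₁).IsInvertible := by
  obtain ⟨T, hT⟩ := hlam
  have hinj : (Φ₂ - Θ ∘L Φ₁).ker = ⊥ := by
    by_contra hk
    obtain ⟨f, hf, hm⟩ := (h.mem_pointSpectrum_iff hΦ hmul).2 hk
    have : (0, f) ∈ resolventRel (extΦ Γ Φ₁ Φ₂) lam := mem_resolventRel.2 (by simpa using hm)
    rw [hT, mem_opGraph, map_zero] at this
    exact hf this
  have hsurj : (Φ₂ - Θ ∘L Φ₁).range = ⊤ := by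
    refine LinearMap.range_eq_top.2 fun v => ?_
    have hv : ((0 : L₁), v) ∈ relRan Γ := hran ▸ Submodule.mem_top
    obtain ⟨⟨⟨f, f'⟩, u⟩, hu, rfl⟩ := hv
    have hT' : (f' - lam • f, T (f' - lam • f)) ∈ resolventRel (extΦ Γ Φ₁ Φ₂) lam := by
      rw [hT, mem_opGraph]
    obtain ⟨x, hx⟩ := mem_resolventRel.1 hT'
    have h1 := ((h _ _ _ _).1 hx).2
    have h2 := ((h _ _ _ _).1 hu).2
    refine ⟨x, ?_⟩
    simp only [add_sub_cancel_right] at h1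
    simp only [map_zero, add_zero] at h2
    simp [h1, h2]
  exact ⟨ContinuousLinearEquiv.ofBijective _ hinj hsurj, rfl⟩

end IsParametrization

end Parametrization

/-! ### Solution operators and their norm continuity in `lam`. -/

section Spaces

variable {H L₁ L₂ K : Type*}
  [NormedAddCommGroup H] [InnerProductSpace ℂ H]
  [NormedAddCommGroup L₁] [InnerProductSpace ℂ L₁]
  [NormedAddCommGroup L₂] [InnerProductSpace ℂ L₂]
  {Γ : BdryRel H L₁ L₂}

/-- The solution `(k, u₁) ↦ ((f, f'), (u₁, u₂))` of `f' - lam f = k` in `Γ`. -/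
def solution (Γ : BdryRel H L₁ L₂) (lam : ℂ) : H × L₁ →L[ℂ] (H × H) × (L₁ × L₂) :=
  Γ.subtypeL ∘L (defectMap Γ lam).inverse

/-- The component `f` of the solution. -/
def solutionState (Γ : BdryRel H L₁ L₂) (lam : ℂ) : H × L₁ →L[ℂ] H :=
  ContinuousLinearMap.fst ℂ H H ∘L ContinuousLinearMap.fst ℂ (H × H) (L₁ × L₂) ∘L solution Γ lam

/-- The component `u₂` of the solution. -/
def solutionOutput (Γ : BdryRel H L₁ L₂) (lam : ℂ) : H × L₁ →L[ℂ] L₂ :=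
  ContinuousLinearMap.snd ℂ L₁ L₂ ∘L ContinuousLinearMap.snd ℂ (H × H) (L₁ × L₂) ∘L solution Γ lam

/-- The operator `k ↦ u₂`, where `((f, lam f + k), (0, u₂)) ∈ Γ`. -/
def outputOp (Γ : BdryRel H L₁ L₂) (lam : ℂ) : H →L[ℂ] L₂ :=
  solutionOutput Γ lam ∘L ContinuousLinearMap.inl ℂ H L₁

/-- The operator `k ↦ f`, where `((f, lam f + k), (0, u₂)) ∈ Γ`. -/
def resolventOp (Γ : BdryRel H L₁ L₂) (lam : ℂ) : H →L[ℂ] H :=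
  solutionState Γ lam ∘L ContinuousLinearMap.inl ℂ H L₁

theorem continuousAt_solution [CompleteSpace Γ] {lam : ℂ}
    (h : (defectMap Γ lam).IsInvertible) : ContinuousAt (solution Γ) lam := by
  obtain ⟨e, he⟩ := h
  have h2 : ContinuousAt ContinuousLinearMap.inverse (defectMap Γ lam) := by
    rw [← he]
    exact (contDiffAt_map_inverse (n := 0) e).continuousAt
  exact continuousAt_const.clm_comp
    (ContinuousAt.comp (f := defectMap Γ) h2 (continuous_defectMap Γ).continuousAt)

variable [CompleteSpace H] {P : PontryaginSymmetry H} {V : LinRel H H}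
  [CompleteSpace L₁] [CompleteSpace L₂]

theorem IsUnitaryBoundaryPair.isParametrization_solution (hΓ : IsUnitaryBoundaryPair P V Γ) {lam : ℂ}
    (hlam : lam ∈ domD Γ) : IsParametrization Γ lam (resolventOp Γ lam)
      (solutionState Γ lam ∘L ContinuousLinearMap.inr ℂ H L₁)
      (outputOp Γ lam) (solutionOutput Γ lam ∘L ContinuousLinearMap.inr ℂ H L₁) := by
  intro f f' u₁ u₂
  obtain ⟨e, he⟩ := hΓ.defectMap_isInvertible hlam
  have hs : ∀ y, solution Γ lam y = (e.symm y : Γ) := fun y => by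
    simp [solution, ← he]
  have hd : ∀ a : Γ, e a = (a.1.1.2 - lam • a.1.1.1, a.1.2.1) := fun a => by
    rw [← defectMap_apply, ← he]
    rfl
  have h1 : resolventOp Γ lam (f' - lam • f) +
      (solutionState Γ lam ∘L ContinuousLinearMap.inr ℂ H L₁) u₁ =
      (solution Γ lam (f' - lam • f, u₁)).1.1 := by
    change solutionState Γ lam _ + solutionState Γ lam _ = _
    rw [← map_add]
    simp [solutionState]
  have h2 : outputOp Γ lam (f' - lam • f) +
      (solutionOutput Γ lam ∘L ContinuousLinearMap.inr ℂ H L₁) u₁ =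
      (solution Γ lam (f' - lam • f, u₁)).2.2 := by
    change solutionOutput Γ lam _ + solutionOutput Γ lam _ = _
    rw [← map_add]
    simp [solutionOutput]
  rw [h1, h2, hs]
  constructor
  · intro hm
    rw [← hd ⟨_, hm⟩, e.symm_apply_apply]
    exact ⟨rfl, rfl⟩
  · rintro ⟨h3, h4⟩
    have h5 := (hd _).symm.trans (e.apply_symm_apply (f' - lam • f, u₁))
    obtain ⟨h6, h7⟩ := Prod.mk.inj h5
    rw [← h3] at h6
    have h8 := sub_left_inj.1 h6
    have h9 := (e.symm (f' - lam • f, u₁)).2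
    convert h9 using 1
    ext
    · exact h3
    · exact h8.symm
    · exact h7.symm
    · exact h4

theorem IsUnitaryBoundaryPair.isParametrization (hΓ : IsUnitaryBoundaryPair P V Γ) {lam : ℂ}
    (hlam : lam ∈ domD Γ) : IsParametrization Γ lam (resolventOp Γ lam) (gamma₁ Γ lam)
      (outputOp Γ lam) (weyl Γ lam) := by
  have key := hΓ.isParametrization_solution hlam
  rw [key.weyl_eq, key.gamma₁_eq]
  exact key

theorem IsUnitaryBoundaryPair.continuousAt_outputOp (hΓ : IsUnitaryBoundaryPair P V Γ) {lam : ℂ}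
    (hlam : lam ∈ domD Γ) : ContinuousAt (outputOp Γ) lam := by
  have := hΓ.completeSpace
  have h := continuousAt_solution (hΓ.defectMap_isInvertible hlam)
  exact (continuousAt_const.clm_comp (continuousAt_const.clm_comp h)).clm_comp continuousAt_const

theorem IsUnitaryBoundaryPair.eventually_mem_domD (hΓ : IsUnitaryBoundaryPair P V Γ) {lam : ℂ}
    (hlam : lam ∈ domD Γ) : ∀ᶠ w in 𝓝 lam, w ∈ domD Γ := by
  have := hΓ.completeSpace
  obtain ⟨e, he⟩ := hΓ.defectMap_isInvertible hlam
  have h1 : ∀ᶠ w in 𝓝 lam, ‖w‖ < 1 := continuous_norm.continuousAt.eventually_lt_const hlam.1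
  -- Isomorphisms form an open set, and injectivity of `defectMap Γ w` excludes `w` from `σ_p(V₁)`.
  have h2 : ∀ᶠ w in 𝓝 lam, defectMap Γ w ∈ Set.range ((↑) : (Γ ≃L[ℂ] H × L₁) → _) :=
    (continuous_defectMap Γ).continuousAt (he ▸ ContinuousLinearEquiv.nhds e)
  filter_upwards [h1, h2] with w hw1 hw2
  obtain ⟨e', he'⟩ := hw2
  refine ⟨hw1, hΓ.defectMap_injective_iff.1 ?_⟩
  rw [← he']
  exact e'.injective

theorem IsUnitaryBoundaryPair.continuousAt_gamma₁ (hΓ : IsUnitaryBoundaryPair P V Γ) {lam : ℂ}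
    (hlam : lam ∈ domD Γ) : ContinuousAt (gamma₁ Γ) lam := by
  have := hΓ.completeSpace
  have h := continuousAt_solution (hΓ.defectMap_isInvertible hlam)
  have h' : ContinuousAt (fun w => solutionState Γ w ∘L ContinuousLinearMap.inr ℂ H L₁) lam :=
    (continuousAt_const.clm_comp (continuousAt_const.clm_comp h)).clm_comp continuousAt_const
  refine h'.congr ?_
  filter_upwards [hΓ.eventually_mem_domD hlam] with w hw
  exact (hΓ.isParametrization_solution hw).gamma₁_eq.symm

end Spaces

/-! ### Duality between the pair and its swap; formulas in the exterior. -/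

section Spaces

variable {H L₁ L₂ K : Type*}
  [NormedAddCommGroup H] [InnerProductSpace ℂ H] [CompleteSpace H]
  [NormedAddCommGroup L₁] [InnerProductSpace ℂ L₁] [CompleteSpace L₁]
  [NormedAddCommGroup L₂] [InnerProductSpace ℂ L₂] [CompleteSpace L₂]
  [NormedAddCommGroup K] [InnerProductSpace ℂ K]
  {P : PontryaginSymmetry H} {V : LinRel H H} {Γ : BdryRel H L₁ L₂}
  {Φ₁ : K →L[ℂ] L₁} {Φ₂ : K →L[ℂ] L₂}

namespace IsUnitaryBoundaryPair

theorem conj_mem_domD_swapRel (hΓ : IsUnitaryBoundaryPair P V Γ) {lam : ℂ} (hlam : lam ∈ domD Γ) :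
    conj lam ∈ domD (swapRel Γ) := by
  refine ⟨by simpa using hlam.1, ?_⟩
  rintro ⟨g, hg, hm⟩
  obtain ⟨v, hv⟩ := mem_ext₁.1 hm
  -- Taking `k = J g` and `u₁ = 0` reduces the Green identity to `[J g, g] = ‖g‖² = 0`.
  have ha := (hΓ.isParametrization hlam).mem (P.J g) 0
  have h := hΓ.form_sub_form_defect ha (g := g) (l := 0) (v₁ := v) (v₂ := 0) (by simpa using hv)
  simp [PontryaginSymmetry.form, P.involutive] at h
  exact hg h

theorem weyl_swapRel (hΓ : IsUnitaryBoundaryPair P V Γ) {lam : ℂ} (hlam : lam ∈ domD Γ) :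
    weyl (swapRel Γ) (conj lam) = ContinuousLinearMap.adjoint (weyl Γ lam) := by
  rw [ContinuousLinearMap.eq_adjoint_iff]
  intro v u
  have ha := (hΓ.isParametrization hlam).mem 0 u
  have hb := (hΓ.swap.isParametrization (hΓ.conj_mem_domD_swapRel hlam)).mem 0 v
  have h := hΓ.form_sub_form_defect ha hb
  simp only [PontryaginSymmetry.form, map_zero, inner_zero_left, inner_zero_right, zero_add,
    sub_zero] at h
  exact sub_eq_zero.1 h.symm

/-- The Green identity for data `(0, u)` at `lam` and `(l, 0)` at `conj lam`. -/
theorem outputOp_swapRel (hΓ : IsUnitaryBoundaryPair P V Γ) {lam : ℂ} (hlam : lam ∈ domD Γ) :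
    outputOp (swapRel Γ) (conj lam) = P.adj (gamma₁ Γ lam) := by
  ext l
  refine ext_inner_right ℂ fun u => ?_
  rw [P.inner_adj]
  have ha := (hΓ.isParametrization hlam).mem 0 u
  have hb := (hΓ.swap.isParametrization (hΓ.conj_mem_domD_swapRel hlam)).mem l 0
  have h := hΓ.form_sub_form_defect ha hb
  simp only [PontryaginSymmetry.form, map_zero, inner_zero_left, inner_zero_right, zero_add,
    add_zero, sub_zero] at h
  exact h.symm

/-- The swap turns `(f, lam f)` into `(lam f, f)`, whose state is `lam f`; this is the origin of the
factor `1 / lam`. -/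
theorem gammaRel₂_eq (hΓ : IsUnitaryBoundaryPair P V Γ) {lam : ℂ} (hlam : lam ∈ domDe Γ) :
    gammaRel₂ Γ lam = opGraph ((1 / lam) • gamma₁ (swapRel Γ) (1 / lam)) := by
  obtain ⟨h0, hm⟩ := mem_domDe_iff.1 hlam
  ext ⟨u₂, f⟩
  have key := fun u₁ =>
    (hΓ.swap.isParametrization hm).mem_defect_iff (lam • f) u₂ (u₁ : L₁)
  simp only [smul_smul, one_div_mul_cancel h0, one_smul, mem_swapRel] at key
  simp only [mem_gammaRel₂, mem_opGraph, key, exists_and_left, exists_eq, and_true]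
  constructor
  · intro h
    rw [smul_apply, ← h, smul_smul, one_div_mul_cancel h0, one_smul]
  · rintro rfl
    rw [smul_apply, smul_smul, mul_one_div_cancel h0, one_smul]

theorem gamma₂_eq (hΓ : IsUnitaryBoundaryPair P V Γ) {lam : ℂ} (hlam : lam ∈ domDe Γ) :
    gamma₂ Γ lam = (1 / lam) • gamma₁ (swapRel Γ) (1 / lam) := by
  rw [gamma₂, hΓ.gammaRel₂_eq hlam, toOp_opGraph]

theorem one_div_conj_mem_domDe (hΓ : IsUnitaryBoundaryPair P V Γ) {lam : ℂ} (hlam : lam ∈ domD Γ)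
    (h0 : lam ≠ 0) : 1 / conj lam ∈ domDe Γ := by
  rw [mem_domDe_iff, one_div_one_div]
  exact ⟨by simpa using h0, hΓ.conj_mem_domD_swapRel hlam⟩

theorem mem_domD_of_conj_mem (hΓ : IsUnitaryBoundaryPair P V Γ) {z : ℂ}
    (hz : z ∈ domD (swapRel Γ)) : conj z ∈ domD Γ :=
  hΓ.swap.conj_mem_domD_swapRel hz

theorem one_div_conj_mem_domD (hΓ : IsUnitaryBoundaryPair P V Γ) {lam : ℂ}
    (hlam : lam ∈ domDe Γ) : 1 / conj lam ∈ domD Γ := by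
  have := hΓ.mem_domD_of_conj_mem (mem_domDe_iff.1 hlam).2
  simpa using this

theorem outputOp_eq (hΓ : IsUnitaryBoundaryPair P V Γ) {lam : ℂ} (hlam : lam ∈ domD Γ)
    (h0 : lam ≠ 0) : outputOp Γ lam = (1 / lam) • gammaSharp₂ P Γ lam := by
  have h := hΓ.swap.outputOp_swapRel (hΓ.conj_mem_domD_swapRel hlam)
  rw [swapRel_swapRel, Complex.conj_conj] at h
  rw [h, gammaSharp₂, hΓ.gamma₂_eq (hΓ.one_div_conj_mem_domDe hlam h0), one_div_one_div]
  ext f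
  simp [PontryaginSymmetry.adj, map_smulₛₗ, smul_smul, h0]

/-- Off `0` the function is `outputOp Γ`, which is defined and norm continuous at `0` as well. -/
theorem tendsto_gammaSharp₂ (hΓ : IsUnitaryBoundaryPair P V Γ) (h0 : (0 : ℂ) ∈ domD Γ) :
    Tendsto (fun w : ℂ => (1 / w) • gammaSharp₂ P Γ w) (𝓝[≠] 0) (𝓝 (outputOp Γ 0)) := by
  refine ((hΓ.continuousAt_outputOp h0).tendsto.mono_left nhdsWithin_le_nhds).congr' ?_
  filter_upwards [nhdsWithin_le_nhds (hΓ.eventually_mem_domD h0), self_mem_nhdsWithin] with w hw hw0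
  exact hΓ.outputOp_eq hw hw0

theorem tendsto_gamma₂ (hΓ : IsUnitaryBoundaryPair P V Γ) (h0 : (0 : ℂ) ∈ domD (swapRel Γ)) :
    Tendsto (fun w : ℂ => gamma₂ Γ (1 / w)) (𝓝[≠] 0) (𝓝 0) := by
  have h1 : Tendsto (fun w : ℂ => w • gamma₁ (swapRel Γ) w) (𝓝 0)
      (𝓝 ((0 : ℂ) • gamma₁ (swapRel Γ) 0)) :=
    tendsto_id.smul (hΓ.swap.continuousAt_gamma₁ h0).tendsto
  rw [zero_smul] at h1
  refine (h1.mono_left nhdsWithin_le_nhds).congr' ?_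
  filter_upwards [nhdsWithin_le_nhds (hΓ.swap.eventually_mem_domD h0), self_mem_nhdsWithin]
    with w hw hw0
  rw [hΓ.gamma₂_eq (mem_domDe_iff.2 ⟨one_div_ne_zero hw0, by rwa [one_div_one_div]⟩),
    one_div_one_div]

/-- Parametrization of `swapRel Γ` in terms of the Weyl function and the γ-field of `Γ`. -/
theorem isParametrization_swapRel (hΓ : IsUnitaryBoundaryPair P V Γ) {z : ℂ}
    (hz : conj z ∈ domD Γ) : IsParametrization (swapRel Γ) z
      (resolventOp (swapRel Γ) z) (gamma₁ (swapRel Γ) z)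
      (P.adj (gamma₁ Γ (conj z))) (ContinuousLinearMap.adjoint (weyl Γ (conj z))) := by
  have hz' := hΓ.conj_mem_domD_swapRel hz
  have h := hΓ.swap.isParametrization hz'
  rw [hΓ.weyl_swapRel hz, hΓ.outputOp_swapRel hz] at h
  rwa [Complex.conj_conj] at h

theorem coresolventRel_ext₂_eq (hΓ : IsUnitaryBoundaryPair P V Γ) {z : ℂ} (hz : conj z ∈ domD Γ) :
    coresolventRel (ext₂ Γ) z =
      opGraph (ContinuousLinearMap.id ℂ H + z • resolventOp (swapRel Γ) z) := by
  refine coresolventRel_eq_opGraph ?_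
  rw [← ext₁_swapRel]
  exact (hΓ.isParametrization_swapRel hz).resolventRel_ext₁_eq

theorem coresolventRel_extΦ_eq (hΓ : IsUnitaryBoundaryPair P V Γ) {z : ℂ} (hz : conj z ∈ domD Γ)
    (hinv : (Φ₁ - ContinuousLinearMap.adjoint (weyl Γ (conj z)) ∘L Φ₂).IsInvertible) :
    coresolventRel (extΦ Γ Φ₁ Φ₂) z = opGraph (toOp (coresolventRel (ext₂ Γ) z) +
      (z • gamma₁ (swapRel Γ) z) ∘L Φ₂ ∘L
        (Φ₁ - ContinuousLinearMap.adjoint (weyl Γ (conj z)) ∘L Φ₂).inverse ∘L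
        P.adj (gamma₁ Γ (conj z))) := by
  have h := (hΓ.isParametrization_swapRel hz).resolventRel_extΦ_eq hinv
  rw [extΦ_swapRel] at h
  rw [coresolventRel_eq_opGraph h, hΓ.coresolventRel_ext₂_eq hz, toOp_opGraph, smul_add,
    ContinuousLinearMap.smul_comp, add_assoc]

theorem smul_gamma₁_swapRel (hΓ : IsUnitaryBoundaryPair P V Γ) {z : ℂ} (hz : conj z ∈ domD Γ)
    (h0 : z ≠ 0) : z • gamma₁ (swapRel Γ) z = gamma₂ Γ (1 / z) := by
  have hz' := hΓ.conj_mem_domD_swapRel hz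
  rw [Complex.conj_conj] at hz'
  rw [hΓ.gamma₂_eq (mem_domDe_iff.2 ⟨one_div_ne_zero h0, by rwa [one_div_one_div]⟩),
    one_div_one_div]

theorem mem_relResolventSet_relInv_extΦ (hΓ : IsUnitaryBoundaryPair P V Γ) {z : ℂ}
    (hz : conj z ∈ domD Γ)
    (hinv : (Φ₁ - ContinuousLinearMap.adjoint (weyl Γ (conj z)) ∘L Φ₂).IsInvertible) :
    z ∈ relResolventSet (relInv (extΦ Γ Φ₁ Φ₂)) := by
  rw [← extΦ_swapRel]
  exact ⟨_, (hΓ.isParametrization_swapRel hz).resolventRel_extΦ_eq hinv⟩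

theorem resolventRel_extΦ_eq_of_mem_domDe (hΓ : IsUnitaryBoundaryPair P V Γ) {lam : ℂ}
    (hlam : lam ∈ domDe Γ) (hinv : (Φ₁ - weylSharp Γ lam ∘L Φ₂).IsInvertible) :
    resolventRel (extΦ Γ Φ₁ Φ₂) lam = opGraph (toOp (resolventRel (ext₂ Γ) lam) -
      (1 / lam) • (gamma₂ Γ lam ∘L Φ₂ ∘L (Φ₁ - weylSharp Γ lam ∘L Φ₂).inverse ∘L
        gammaSharp₁ P Γ lam)) := by
  have h0 := (mem_domDe_iff.1 hlam).1
  have e : conj (1 / lam) = 1 / conj lam := by simp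
  have hz : conj (1 / lam) ∈ domD Γ := e ▸ hΓ.one_div_conj_mem_domD hlam
  simp only [weylSharp, gammaSharp₁, ← e] at hinv ⊢
  have h := hΓ.coresolventRel_extΦ_eq hz hinv
  rw [hΓ.smul_gamma₁_swapRel hz (one_div_ne_zero h0), one_div_one_div,
    hΓ.coresolventRel_ext₂_eq hz, toOp_opGraph] at h
  rw [resolventRel_eq_opGraph_of_coresolventRel h0 h,
    resolventRel_eq_opGraph_of_coresolventRel h0 (hΓ.coresolventRel_ext₂_eq hz), toOp_opGraph,
    smul_add, neg_add, ← sub_eq_add_neg]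

theorem resolventRel_extΦ_eq_of_ne_zero (hΓ : IsUnitaryBoundaryPair P V Γ) {lam : ℂ}
    (hlam : lam ∈ domD Γ) (h0 : lam ≠ 0) (hinv : (Φ₂ - weyl Γ lam ∘L Φ₁).IsInvertible) :
    resolventRel (extΦ Γ Φ₁ Φ₂) lam = opGraph (toOp (resolventRel (ext₁ Γ) lam) +
      (1 / lam) • (gamma₁ Γ lam ∘L Φ₁ ∘L (Φ₂ - weyl Γ lam ∘L Φ₁).inverse ∘L
        gammaSharp₂ P Γ lam)) := by
  have hp := hΓ.isParametrization hlam
  rw [hp.resolventRel_extΦ_eq hinv, hp.resolventRel_ext₁_eq, toOp_opGraph,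
    hΓ.outputOp_eq hlam h0]
  simp only [ContinuousLinearMap.comp_smul]

theorem coresolventRel_extΦ_eq_of_mem_domDe (hΓ : IsUnitaryBoundaryPair P V Γ) {z : ℂ}
    (hz : conj z ∈ domDe Γ) (hinv : (Φ₂ - weyl Γ (1 / z) ∘L Φ₁).IsInvertible) :
    coresolventRel (extΦ Γ Φ₁ Φ₂) z = opGraph (toOp (coresolventRel (ext₁ Γ) z) -
      gamma₁ Γ (1 / z) ∘L Φ₁ ∘L (Φ₂ - weyl Γ (1 / z) ∘L Φ₁).inverse ∘L
        P.adj (gamma₂ Γ (conj z))) := by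
  have h0 : z ≠ 0 := by simpa using (mem_domDe_iff.1 hz).1
  have hlam := hΓ.one_div_conj_mem_domD hz
  rw [Complex.conj_conj] at hlam
  have hp := hΓ.isParametrization hlam
  have h := coresolventRel_eq_opGraph_of_resolventRel (one_div_ne_zero h0)
    (hΓ.resolventRel_extΦ_eq_of_ne_zero hlam (one_div_ne_zero h0) hinv)
  have h' := coresolventRel_eq_opGraph_of_resolventRel (one_div_ne_zero h0) hp.resolventRel_ext₁_eq
  rw [one_div_one_div] at h h'
  -- The prefactor `z` of the resolvent formula at `1 / z` cancels the `-1 / z` of the coresolvent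
  -- up to sign.
  rw [h, h', toOp_opGraph, hp.resolventRel_ext₁_eq, toOp_opGraph, smul_add, smul_smul,
    one_div_mul_cancel h0, one_smul, neg_add, ← sub_eq_add_neg, gammaSharp₂]
  simp

end IsUnitaryBoundaryPair

theorem eq_zero_of_ker_eq_bot [CompleteSpace K]
    (hΦ : (ContinuousLinearMap.adjoint Φ₁ ∘L Φ₁ + ContinuousLinearMap.adjoint Φ₂ ∘L Φ₂).ker = ⊥)
    (x : K) (h₁ : Φ₁ x = 0) (h₂ : Φ₂ x = 0) : x = 0 := by
  rw [← Submodule.mem_bot ℂ, ← hΦ]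
  simp [h₁, h₂]

end Spaces

end

end BoundaryPair

/-! ### The theorem and the corollary. -/

theorem mainTheorem4
    {H L₁ L₂ K : Type*}
    [NormedAddCommGroup H] [InnerProductSpace ℂ H] [CompleteSpace H]
    [NormedAddCommGroup L₁] [InnerProductSpace ℂ L₁] [CompleteSpace L₁]
    [NormedAddCommGroup L₂] [InnerProductSpace ℂ L₂] [CompleteSpace L₂]
    [NormedAddCommGroup K] [InnerProductSpace ℂ K] [CompleteSpace K]
    (P : PontryaginSymmetry H)
    (V : LinRel H H) (hV : IsClosedIsometricOperator P V)
    (Γ : BdryRel H L₁ L₂) (hΓ : IsUnitaryBoundaryPair P V Γ)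
    (Φ₁ : K →L[ℂ] L₁) (Φ₂ : K →L[ℂ] L₂)
    (hΦ : (ContinuousLinearMap.adjoint Φ₁ ∘L Φ₁ + ContinuousLinearMap.adjoint Φ₂ ∘L Φ₂).ker = ⊥) :
    -- the operators and resolvents in the formulas below are well defined
    (∀ lam ∈ domD Γ, IsBoundedOp (weylFamily Γ lam) ∧ IsBoundedOp (gammaRel₁ Γ lam) ∧
      lam ∈ relResolventSet (ext₁ Γ) ∧ (lam ≠ 0 → 1 / conj lam ∈ domDe Γ)) ∧
    (∀ lam ∈ domDe Γ, IsBoundedOp (gammaRel₂ Γ lam) ∧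
      lam ∈ relResolventSet (ext₂ Γ) ∧ 1 / conj lam ∈ domD Γ) ∧
    (∀ z : ℂ, conj z ∈ domD Γ → IsBoundedOp (coresolventRel (ext₂ Γ) z)) ∧
    (∀ z : ℂ, conj z ∈ domDe Γ → IsBoundedOp (coresolventRel (ext₁ Γ) z)) ∧
    -- the theorem, for `lam ∈ 𝒟`
    (∀ lam ∈ domD Γ,
      (lam ∈ pointSpectrum (extΦ Γ Φ₁ Φ₂) → (Φ₂ - weyl Γ lam ∘L Φ₁).ker ≠ ⊥) ∧
      ((Φ₂ - weyl Γ lam ∘L Φ₁).IsInvertible →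
        lam ∈ relResolventSet (extΦ Γ Φ₁ Φ₂) ∧
        (lam ≠ 0 →
          resolventRel (extΦ Γ Φ₁ Φ₂) lam =
            opGraph (toOp (resolventRel (ext₁ Γ) lam) +
              (1 / lam) • (gamma₁ Γ lam ∘L Φ₁ ∘L (Φ₂ - weyl Γ lam ∘L Φ₁).inverse ∘L
                gammaSharp₂ P Γ lam))) ∧
        -- at `lam = 0` the factor `(1 / lam) γ₂^#(lam)` is read as its limit
        (lam = 0 →
          ∃ G : H →L[ℂ] L₂,
            Tendsto (fun w : ℂ => (1 / w) • gammaSharp₂ P Γ w) (𝓝[≠] 0) (𝓝 G) ∧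
            resolventRel (extΦ Γ Φ₁ Φ₂) lam =
              opGraph (toOp (resolventRel (ext₁ Γ) lam) +
                gamma₁ Γ lam ∘L Φ₁ ∘L (Φ₂ - weyl Γ lam ∘L Φ₁).inverse ∘L G)))) ∧
    -- the theorem, for `lam ∈ 𝒟_e`
    (∀ lam ∈ domDe Γ,
      (lam ∈ pointSpectrum (extΦ Γ Φ₁ Φ₂) → (Φ₁ - weylSharp Γ lam ∘L Φ₂).ker ≠ ⊥) ∧
      ((Φ₁ - weylSharp Γ lam ∘L Φ₂).IsInvertible →
        lam ∈ relResolventSet (extΦ Γ Φ₁ Φ₂) ∧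
        resolventRel (extΦ Γ Φ₁ Φ₂) lam =
          opGraph (toOp (resolventRel (ext₂ Γ) lam) -
            (1 / lam) • (gamma₂ Γ lam ∘L Φ₂ ∘L (Φ₁ - weylSharp Γ lam ∘L Φ₂).inverse ∘L
              gammaSharp₁ P Γ lam)))) ∧
    -- the corollary, for `z` in the complex conjugate of `𝒟`
    (∀ z : ℂ, conj z ∈ domD Γ →
      (z ∈ pointSpectrum (relInv (extΦ Γ Φ₁ Φ₂)) →
        (Φ₁ - ContinuousLinearMap.adjoint (weyl Γ (conj z)) ∘L Φ₂).ker ≠ ⊥) ∧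
      ((Φ₁ - ContinuousLinearMap.adjoint (weyl Γ (conj z)) ∘L Φ₂).IsInvertible →
        z ∈ relResolventSet (relInv (extΦ Γ Φ₁ Φ₂)) ∧
        (z ≠ 0 →
          coresolventRel (extΦ Γ Φ₁ Φ₂) z =
            opGraph (toOp (coresolventRel (ext₂ Γ) z) +
              gamma₂ Γ (1 / z) ∘L Φ₂ ∘L
                (Φ₁ - ContinuousLinearMap.adjoint (weyl Γ (conj z)) ∘L Φ₂).inverse ∘L
                P.adj (gamma₁ Γ (conj z)))) ∧
        -- at `z = 0` the factor `γ₂(1 / z)` is read as its limit, which is `0`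
        (z = 0 →
          Tendsto (fun w : ℂ => gamma₂ Γ (1 / w)) (𝓝[≠] 0) (𝓝 0) ∧
            coresolventRel (extΦ Γ Φ₁ Φ₂) z = opGraph (toOp (coresolventRel (ext₂ Γ) z))))) ∧
    -- the corollary, for `z` in the complex conjugate of `𝒟_e`
    (∀ z : ℂ, conj z ∈ domDe Γ →
      (z ∈ pointSpectrum (relInv (extΦ Γ Φ₁ Φ₂)) →
        (Φ₂ - weyl Γ (1 / z) ∘L Φ₁).ker ≠ ⊥) ∧
      ((Φ₂ - weyl Γ (1 / z) ∘L Φ₁).IsInvertible →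
        z ∈ relResolventSet (relInv (extΦ Γ Φ₁ Φ₂)) ∧
        coresolventRel (extΦ Γ Φ₁ Φ₂) z =
          opGraph (toOp (coresolventRel (ext₁ Γ) z) -
            gamma₁ Γ (1 / z) ∘L Φ₁ ∘L (Φ₂ - weyl Γ (1 / z) ∘L Φ₁).inverse ∘L
              P.adj (gamma₂ Γ (conj z))))) ∧
    -- all implications become equivalences for an ordinary boundary triple
    (IsOrdinary P V Γ →
      (∀ lam ∈ domD Γ,
        (lam ∈ pointSpectrum (extΦ Γ Φ₁ Φ₂) ↔ (Φ₂ - weyl Γ lam ∘L Φ₁).ker ≠ ⊥) ∧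
        ((Φ₂ - weyl Γ lam ∘L Φ₁).IsInvertible ↔ lam ∈ relResolventSet (extΦ Γ Φ₁ Φ₂))) ∧
      (∀ lam ∈ domDe Γ,
        (lam ∈ pointSpectrum (extΦ Γ Φ₁ Φ₂) ↔ (Φ₁ - weylSharp Γ lam ∘L Φ₂).ker ≠ ⊥) ∧
        ((Φ₁ - weylSharp Γ lam ∘L Φ₂).IsInvertible ↔ lam ∈ relResolventSet (extΦ Γ Φ₁ Φ₂))) ∧
      (∀ z : ℂ, conj z ∈ domD Γ →
        (z ∈ pointSpectrum (relInv (extΦ Γ Φ₁ Φ₂)) ↔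
          (Φ₁ - ContinuousLinearMap.adjoint (weyl Γ (conj z)) ∘L Φ₂).ker ≠ ⊥) ∧
        ((Φ₁ - ContinuousLinearMap.adjoint (weyl Γ (conj z)) ∘L Φ₂).IsInvertible ↔
          z ∈ relResolventSet (relInv (extΦ Γ Φ₁ Φ₂)))) ∧
      (∀ z : ℂ, conj z ∈ domDe Γ →
        (z ∈ pointSpectrum (relInv (extΦ Γ Φ₁ Φ₂)) ↔ (Φ₂ - weyl Γ (1 / z) ∘L Φ₁).ker ≠ ⊥) ∧
        ((Φ₂ - weyl Γ (1 / z) ∘L Φ₁).IsInvertible ↔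
          z ∈ relResolventSet (relInv (extΦ Γ Φ₁ Φ₂))))) := by
  have hmul : IsOrdinary P V Γ → ∀ u₁ u₂, ((0 : H × H), (u₁, u₂)) ∈ Γ → u₁ = 0 ∧ u₂ = 0 :=
    fun ho => eq_zero_of_mem_of_relMul_eq_bot ho.mul₁ ho.mul₂
  have hmul' : IsOrdinary P V Γ →
      ∀ u₂ u₁, ((0 : H × H), (u₂, u₁)) ∈ swapRel Γ → u₂ = 0 ∧ u₁ = 0 :=
    fun ho u₂ u₁ h => (hmul ho u₁ u₂ h).symm
  have hran' : IsOrdinary P V Γ → relRan (swapRel Γ) = ⊤ := fun ho => by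
    refine Submodule.eq_top_iff'.2 fun u => ?_
    have hu : u.swap ∈ relRan Γ := ho.ran_eq ▸ Submodule.mem_top
    obtain ⟨⟨f, v⟩, hv, hvu⟩ := hu
    exact ⟨(f.swap, v.swap), hv, Prod.swap_inj.1 hvu⟩
  have hΦ₁ := eq_zero_of_ker_eq_bot hΦ
  have hΦ₂ : ∀ x, Φ₂ x = 0 → Φ₁ x = 0 → x = 0 := fun x h₂ h₁ => hΦ₁ x h₁ h₂
  -- the points `1 / lam` and `1 / z`
  have hDe : ∀ lam ∈ domDe Γ, lam ≠ 0 ∧ conj (1 / lam) ∈ domD Γ ∧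
      weylSharp Γ lam = ContinuousLinearMap.adjoint (weyl Γ (conj (1 / lam))) := fun lam hlam => by
    refine ⟨(mem_domDe_iff.1 hlam).1, ?_, by simp [weylSharp]⟩
    simpa using hΓ.one_div_conj_mem_domD hlam
  have hcDe : ∀ z : ℂ, conj z ∈ domDe Γ → z ≠ 0 ∧ 1 / z ∈ domD Γ := fun z hz => by
    refine ⟨by simpa using (mem_domDe_iff.1 hz).1, ?_⟩
    simpa using hΓ.one_div_conj_mem_domD hz
  have hswap : ∀ z : ℂ, conj z ∈ domD Γ →
      (z ∈ pointSpectrum (relInv (extΦ Γ Φ₁ Φ₂)) →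
        (Φ₁ - ContinuousLinearMap.adjoint (weyl Γ (conj z)) ∘L Φ₂).ker ≠ ⊥) := fun z hz h => by
    rw [← extΦ_swapRel] at h
    exact (hΓ.isParametrization_swapRel hz).ker_ne_bot_of_mem_pointSpectrum h
  have hswap' : IsOrdinary P V Γ → ∀ z : ℂ, conj z ∈ domD Γ →
      (z ∈ pointSpectrum (relInv (extΦ Γ Φ₁ Φ₂)) ↔
        (Φ₁ - ContinuousLinearMap.adjoint (weyl Γ (conj z)) ∘L Φ₂).ker ≠ ⊥) ∧
      ((Φ₁ - ContinuousLinearMap.adjoint (weyl Γ (conj z)) ∘L Φ₂).IsInvertible ↔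
        z ∈ relResolventSet (relInv (extΦ Γ Φ₁ Φ₂))) := fun ho z hz => by
    refine ⟨?_, hΓ.mem_relResolventSet_relInv_extΦ hz, ?_⟩
    all_goals rw [← extΦ_swapRel]
    · exact (hΓ.isParametrization_swapRel hz).mem_pointSpectrum_iff hΦ₂ (hmul' ho)
    · exact (hΓ.isParametrization_swapRel hz).isInvertible_of_mem_relResolventSet hΦ₂ (hmul' ho)
        (hran' ho)
  have hord : IsOrdinary P V Γ → ∀ lam ∈ domD Γ,
      (lam ∈ pointSpectrum (extΦ Γ Φ₁ Φ₂) ↔ (Φ₂ - weyl Γ lam ∘L Φ₁).ker ≠ ⊥) ∧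
      ((Φ₂ - weyl Γ lam ∘L Φ₁).IsInvertible ↔ lam ∈ relResolventSet (extΦ Γ Φ₁ Φ₂)) :=
    fun ho lam hlam =>
      have hp := hΓ.isParametrization hlam
      ⟨hp.mem_pointSpectrum_iff hΦ₁ (hmul ho), fun h => ⟨_, hp.resolventRel_extΦ_eq h⟩,
        hp.isInvertible_of_mem_relResolventSet hΦ₁ (hmul ho) ho.ran_eq⟩
  have hspec : ∀ z : ℂ, z ≠ 0 →
      (z ∈ pointSpectrum (relInv (extΦ Γ Φ₁ Φ₂)) ↔ 1 / z ∈ pointSpectrum (extΦ Γ Φ₁ Φ₂)) :=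
    fun z h0 => by rw [← mem_pointSpectrum_relInv (one_div_ne_zero h0), one_div_one_div]
  have hres : ∀ z : ℂ, z ≠ 0 →
      (z ∈ relResolventSet (relInv (extΦ Γ Φ₁ Φ₂)) ↔ 1 / z ∈ relResolventSet (extΦ Γ Φ₁ Φ₂)) :=
    fun z h0 => by rw [← mem_relResolventSet_relInv (one_div_ne_zero h0), one_div_one_div]
  refine ⟨fun lam hlam => ?_, fun lam hlam => ?_, fun z hz => ⟨_, hΓ.coresolventRel_ext₂_eq hz⟩,
    fun z hz => ?_, fun lam hlam => ?_, fun lam hlam => ?_, fun z hz => ?_, fun z hz => ?_,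
    fun ho => ⟨hord ho, fun lam hlam => ?_, hswap' ho, fun z hz => ?_⟩⟩
  · have hp := hΓ.isParametrization hlam
    exact ⟨⟨_, hp.weylFamily_eq⟩, ⟨_, hp.gammaRel₁_eq⟩, ⟨_, hp.resolventRel_ext₁_eq⟩,
      hΓ.one_div_conj_mem_domDe hlam⟩
  · obtain ⟨h0, hz, -⟩ := hDe lam hlam
    exact ⟨⟨_, hΓ.gammaRel₂_eq hlam⟩,
      ⟨_, resolventRel_eq_opGraph_of_coresolventRel h0 (hΓ.coresolventRel_ext₂_eq hz)⟩,
      hΓ.one_div_conj_mem_domD hlam⟩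
  · obtain ⟨h0, hlam⟩ := hcDe z hz
    have h := coresolventRel_eq_opGraph_of_resolventRel (one_div_ne_zero h0)
      (hΓ.isParametrization hlam).resolventRel_ext₁_eq
    rw [one_div_one_div] at h
    exact ⟨_, h⟩
  · have hp := hΓ.isParametrization hlam
    refine ⟨hp.ker_ne_bot_of_mem_pointSpectrum, fun hinv => ⟨⟨_, hp.resolventRel_extΦ_eq hinv⟩,
      fun h0 => hΓ.resolventRel_extΦ_eq_of_ne_zero hlam h0 hinv, ?_⟩⟩
    rintro rfl
    refine ⟨_, hΓ.tendsto_gammaSharp₂ hlam, ?_⟩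
    rw [hp.resolventRel_ext₁_eq, toOp_opGraph]
    exact hp.resolventRel_extΦ_eq hinv
  · obtain ⟨h0, hz, hw⟩ := hDe lam hlam
    refine ⟨fun h => ?_, fun hinv => ?_⟩
    · rw [hw]
      exact hswap _ hz ((mem_pointSpectrum_relInv h0).2 h)
    · have h := hΓ.resolventRel_extΦ_eq_of_mem_domDe hlam hinv
      exact ⟨⟨_, h⟩, h⟩
  · refine ⟨hswap z hz, fun hinv => ⟨hΓ.mem_relResolventSet_relInv_extΦ hz hinv, fun h0 => ?_, ?_⟩⟩
    · rw [← hΓ.smul_gamma₁_swapRel hz h0]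
      exact hΓ.coresolventRel_extΦ_eq hz hinv
    · rintro rfl
      refine ⟨hΓ.tendsto_gamma₂ (by simpa using hΓ.conj_mem_domD_swapRel hz), ?_⟩
      -- The formula with `z • gamma₁ (swapRel Γ) z` in place of `γ₂(1 / z)` remains valid at `z =
      -- 0`, where this factor vanishes.
      rw [hΓ.coresolventRel_extΦ_eq hz hinv, zero_smul, ContinuousLinearMap.zero_comp, add_zero]
  · obtain ⟨h0, hlam⟩ := hcDe z hz
    have hp := hΓ.isParametrization hlam
    rw [hspec z h0, hres z h0]
    exact ⟨hp.ker_ne_bot_of_mem_pointSpectrum, fun hinv => ⟨⟨_, hp.resolventRel_extΦ_eq hinv⟩,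
      hΓ.coresolventRel_extΦ_eq_of_mem_domDe hz hinv⟩⟩
  · obtain ⟨h0, hz, hw⟩ := hDe lam hlam
    rw [hw, ← mem_pointSpectrum_relInv h0, ← mem_relResolventSet_relInv h0]
    exact hswap' ho _ hz
  · obtain ⟨h0, hlam⟩ := hcDe z hz
    rw [hspec z h0, hres z h0]
    exact hord ho _ hlam
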